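/- Fix an integer $p\ge 2$. For integers $n\ge 0$, $d\ge 1$ let $X=(X_{ri})_{1\le r\le n,\,1\le i\le d}$ be a random matrix with i.i.d. standard Gaussian entries, and let $\Delta_p$ be the set of $p$-tuples $\mathbf j=(j_1,\dots,j_p)\in\{1,\dots,n\}^p$ of mutually distinct indices, so that $|\Delta_p|=\nu:=p!\binom np$. Define the random vector $\mathcal Y_{n,d}=(Y_{\mathbf j})_{\mathbf j\in\Delta_p}\in\mathbb R^{\nu}$ by $$Y_{\mathbf j}=\frac1{\sqrt d}\sum_{i=1}^d\prod_{k=1}^pX_{j_ki}.$$ Let $Z_\nu=(Z_{\mathbf j})_{\mathbf j\in\Delta_p}\in\mathbb R^\nu$ be a standard Gaussian symmetric off-diagonal $p$-tensor: $Z_{(j_{\sigma(1)},\dots,j_{\sigma(p)})}=Z_{(j_1,\dots,j_p)}$ almost surely for every $\mathbf j\in\Delta_p$ and every permutation $\sigma$ of $\{1,\dots,p\}$, and the $\binom np$ coordinates $Z_{\mathbf j}$ with $j_1<\dots<j_p$ are i.i.d. standard Gaussian. Let $$d_{\rm Wass}(U,V)=\sup\{\mathbb E[g(U)]-\mathbb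 E[g(V)] : g:\mathbb R^\nu\to\mathbb R \text{ is 1-Lipschitz for the Euclidean norm}\}.$$ Then there is a constant $C=C(p)>0$, depending only on $p$, such that for all $n\ge 0$ and $d\ge 1$ $$d_{\rm Wass}(\mathcal Y_{n,d},Z_\nu)\le C\sqrt{n^{2p-1}/d}.$$ In particular, $d_{\rm Wass}(\mathcal Y_{n,d},Z_\nu)\to 0$ along any sequence of pairs $(n,d)$ with $n^{2p-1}/d\to0$. -/

import Mathlib

open MeasureTheory ProbabilityTheory Filter
open scoped ENNReal NNReal Topology

noncomputable section

/-- The index set of off-diagonal `p`-tensors over `{1, …, n}`: `p`-tuples `(j₁, …, j_p)` of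
mutually distinct indices, that is, injective maps from `Fin p` to `Fin n`. -/
abbrev OffDiag (p n : ℕ) : Type := Fin p ↪ Fin n

/-- The number of off-diagonal indices is `ν = p! * (n choose p)`. -/
theorem card_offDiag (p n : ℕ) :
    Fintype.card (OffDiag p n) = p.factorial * n.choose p := by
  rw [Fintype.card_embedding_eq, Fintype.card_fin, Fintype.card_fin,
    Nat.descFactorial_eq_factorial_mul_choose]

/-- The off-diagonal `p`-tensor `Y_j = d^{-1/2} ∑ᵢ ∏ₖ x_{j_k i}` built from an `n × d` matrix `x`,
as a vector of the Euclidean space of dimension `p! * (n choose p)`. -/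
def offDiagTensor (p : ℕ) {n d : ℕ} (x : Fin n → Fin d → ℝ) :
    EuclideanSpace ℝ (OffDiag p n) :=
  WithLp.toLp 2 fun j => (Real.sqrt d)⁻¹ * ∑ i : Fin d, ∏ k : Fin p, x (j k) i

/-- The entries of the random `n × d` matrix `X` are i.i.d. standard Gaussian under `P`. -/
structure IsStdGaussianMatrix {Ω : Type*} [MeasurableSpace Ω] (P : Measure Ω) {n d : ℕ}
    (X : Fin n → Fin d → Ω → ℝ) : Prop where
  hasLaw : ∀ r i, HasLaw (X r i) (gaussianReal 0 1) P
  indep : iIndepFun (fun (a : Fin n × Fin d) => X a.1 a.2) P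

/-- `Z` is a standard Gaussian off-diagonal *symmetric* `p`-tensor under `P`: it is invariant
under permutations of the `p` slots of its index, every coordinate is standard Gaussian, and the
coordinates with strictly increasing index are independent. -/
structure IsStdGaussianSymmTensor {Ω : Type*} [MeasurableSpace Ω] (P : Measure Ω) {p n : ℕ}
    (Z : Ω → EuclideanSpace ℝ (OffDiag p n)) : Prop where
  symm : ∀ (σ : Equiv.Perm (Fin p)) (j : OffDiag p n),
    ∀ᵐ ω ∂P, Z ω (σ.toEmbedding.trans j) = Z ω j
  hasLaw : ∀ j : OffDiag p n, HasLaw (fun ω => Z ω j) (gaussianReal 0 1) P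
  indep : iIndepFun (fun (j : {j : OffDiag p n // StrictMono j}) (ω : Ω) => Z ω j.1) P

/-- The Wasserstein distance `sup { E[g(U)] - E[g(V)] : ‖g‖_Lip ≤ 1 }` between two random elements
`U`, `V` (with finite first moment), possibly defined on different probability spaces. The supremum
is taken in `[0, ∞]`; the constant functions `g` show that it is nonnegative in any case. -/
def wassersteinDist {Ω Ω' E : Type*} [MeasurableSpace Ω] [MeasurableSpace Ω']
    [PseudoEMetricSpace E] (P : Measure Ω) (U : Ω → E) (P' : Measure Ω') (V : Ω' → E) : ℝ≥0∞ :=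
  ⨆ (g : E → ℝ) (_ : LipschitzWith 1 g),
    ENNReal.ofReal ((∫ ω, g (U ω) ∂P) - ∫ ω, g (V ω) ∂P')

end

/-! ### Gaussian integration by parts -/

-- The proof combines Stein kernels with a trigonometric interpolation. Permuting an index changes
-- neither tensor, so both are images of vectors indexed by the `p`-subsets `A` of the rows under
-- one linear map, `symmTensor`, whose Lipschitz constant depends only on `p`. It remains to compare
-- `F_A = d^{-1/2} ∑ᵢ ∏_{k ∈ A} x_{ki}` with a standard Gaussian vector `Z`.
--
-- Choose a row `r(A) ∈ A`. Gaussian integration by parts in the variables `x_{r(A) i}` gives `F`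
-- the explicit Stein kernel `τ_{AB} = d⁻¹ ∑ᵢ ∏_{A \ r(A)} x_{ki} ∏_{B \ r(A)} x_{ki}`, read as `0`
-- when `r(A) ∉ B` (`isSteinKernel_setTensor`). Its mean is the identity matrix, and since columns
-- are independent each entry has variance `O(1/d)`. Only pairs with `r(A) ∈ B` contribute, and
-- there are at most `n^p · n^(p-1)` of them. This produces the exponent `2p-1`
-- (`steinDiscrepancySq_setTensor_le`).
--
-- A general bound then controls the Wasserstein distance by `‖τ - I‖` in `L²`
-- (`IsSteinKernel.abs_integral_sub_integral_le`). Along `U = sin θ F + cos θ Z`, the derivative of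
-- `E f(U)` is `sin θ cos θ E⟨τ - I, Hess f(U)⟩`. Integrating by parts back in `Z` turns it into
-- `sin θ E[∇f(U) · (τ - I)Z]`, which involves only the Lipschitz constant of `f`. The
-- second-derivative bound needed along the way does not enter the estimate, so smoothing extends it
-- to all Lipschitz functions.

theorem hasDerivAt_gaussianPDFReal_zero_one (t : ℝ) :
    HasDerivAt (gaussianPDFReal 0 1) (-(t * gaussianPDFReal 0 1 t)) t := by
  have h : HasDerivAt (fun x : ℝ => -(x - 0) ^ 2 / (2 * ((1 : ℝ≥0) : ℝ))) (-t) t := by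
    have := (((hasDerivAt_id t).sub_const 0).pow 2).neg.div_const (2 * ((1 : ℝ≥0) : ℝ))
    convert! this using 1
    simp only [NNReal.coe_one, id_eq]
    push_cast
    ring
  have := (h.exp).const_mul (√(2 * Real.pi * ((1 : ℝ≥0) : ℝ)))⁻¹
  rw [gaussianPDFReal_def]
  convert! this using 1
  ring

theorem integrable_gaussianReal_iff_integrable_mul {f : ℝ → ℝ} :
    Integrable f (gaussianReal 0 1) ↔ Integrable fun t => f t * gaussianPDFReal 0 1 t := by
  rw [gaussianReal_of_var_ne_zero _ one_ne_zero,
    integrable_withDensity_iff (measurable_gaussianPDF 0 1)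
      (ae_of_all _ fun _ => gaussianPDF_lt_top)]
  simp [gaussianPDF, ENNReal.toReal_ofReal, gaussianPDFReal_nonneg]

/-- **Stein's identity** for the standard Gaussian measure on the line. -/
theorem integral_id_mul_gaussianReal {h h' : ℝ → ℝ} (hd : ∀ t, HasDerivAt h (h' t) t)
    (hi : Integrable h (gaussianReal 0 1))
    (hti : Integrable (fun t => t * h t) (gaussianReal 0 1))
    (hi' : Integrable h' (gaussianReal 0 1)) :
    ∫ t, t * h t ∂gaussianReal 0 1 = ∫ t, h' t ∂gaussianReal 0 1 := by
  rw [integrable_gaussianReal_iff_integrable_mul] at hi hti hi'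
  have := integral_mul_deriv_eq_deriv_mul_of_integrable (u := h) (u' := h')
    (v := gaussianPDFReal 0 1) (v' := fun t => -(t * gaussianPDFReal 0 1 t))
    (fun t _ => hd t) (fun t _ => hasDerivAt_gaussianPDFReal_zero_one t)
    (hti.neg.congr (ae_of_all _ fun t => by simp only [Pi.neg_apply, Pi.mul_apply]; ring)) hi' hi
  rw [integral_gaussianReal_eq_integral_smul one_ne_zero,
    integral_gaussianReal_eq_integral_smul one_ne_zero]
  simp only [smul_eq_mul]
  rw [← neg_inj, ← integral_neg]
  calc _ = ∫ t, h t * -(t * gaussianPDFReal 0 1 t) := by congr 1; ext t; ring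
    _ = _ := by rw [this]; congr 2; ext t; ring

/-- Resampling one coordinate preserves a product measure. -/
theorem measurePreserving_update {κ : Type*} [Fintype κ] [DecidableEq κ] {α : κ → Type*}
    [∀ k, MeasurableSpace (α k)] (μ : ∀ k, Measure (α k)) [∀ k, IsProbabilityMeasure (μ k)]
    (s : κ) :
    MeasurePreserving (fun q : (∀ k, α k) × α s => Function.update q.1 s q.2)
      ((Measure.pi μ).prod (μ s)) (Measure.pi μ) := by
  have hm : Measurable fun q : (∀ k, α k) × α s => Function.update q.1 s q.2 := by
    refine measurable_pi_lambda _ fun k => ?_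
    rcases eq_or_ne k s with rfl | hk
    · simpa using measurable_snd
    · simp only [Function.update_of_ne hk]
      fun_prop
  refine ⟨hm, (Measure.pi_eq fun B hB => ?_).symm⟩
  rw [Measure.map_apply hm (MeasurableSet.univ_pi hB)]
  have : (fun q : (∀ k, α k) × α s => Function.update q.1 s q.2) ⁻¹' Set.univ.pi B
      = (Set.univ.pi (Function.update B s Set.univ)) ×ˢ B s := by
    ext q
    simp only [Set.mem_preimage, Set.mem_pi, Set.mem_univ, true_imp_iff, Set.mem_prod]
    constructor
    · intro h
      refine ⟨fun k => ?_, by simpa using h s⟩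
      rcases eq_or_ne k s with rfl | hk
      · simp
      · simpa [Function.update_of_ne hk] using h k
    · rintro ⟨h, h'⟩ k
      rcases eq_or_ne k s with rfl | hk
      · simpa using h'
      · simpa [Function.update_of_ne hk] using h k
  rw [this, Measure.prod_prod, Measure.pi_pi, ← Finset.mul_prod_erase _ _ (Finset.mem_univ s),
    ← Finset.mul_prod_erase (Finset.univ) (fun i => μ i (B i)) (Finset.mem_univ s)]
  simp only [Function.update_self, measure_univ, one_mul]
  rw [mul_comm]
  congr 1
  refine Finset.prod_congr rfl fun k hk => ?_
  rw [Function.update_of_ne (Finset.ne_of_mem_erase hk)]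

/-- Fubini in the form of resampling one coordinate: the functions stay on the full product, with no
splitting of the index type. -/
theorem integral_pi_eq_integral_integral_update {κ : Type*} [Fintype κ] [DecidableEq κ]
    {α : κ → Type*} [∀ k, MeasurableSpace (α k)] (μ : ∀ k, Measure (α k))
    [∀ k, IsProbabilityMeasure (μ k)] (s : κ) {G : (∀ k, α k) → ℝ}
    (hG : Integrable G (Measure.pi μ)) :
    ∫ x, G x ∂Measure.pi μ = ∫ x, ∫ t, G (Function.update x s t) ∂μ s ∂Measure.pi μ := by
  have hU := measurePreserving_update μ s
  have hG' : Integrable G (Measure.map (fun q : (∀ k, α k) × α s => Function.update q.1 s q.2)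
      ((Measure.pi μ).prod (μ s))) := by rwa [hU.map_eq]
  calc ∫ x, G x ∂Measure.pi μ
      = ∫ q, G (Function.update q.1 s q.2) ∂((Measure.pi μ).prod (μ s)) := by
        conv_lhs => rw [← hU.map_eq]
        exact integral_map hU.measurable.aemeasurable hG'.1
    _ = _ := integral_prod _ ((integrable_map_measure hG'.1 hU.measurable.aemeasurable).1 hG')

theorem ae_integrable_update {κ : Type*} [Fintype κ] [DecidableEq κ]
    {α : κ → Type*} [∀ k, MeasurableSpace (α k)] (μ : ∀ k, Measure (α k))
    [∀ k, IsProbabilityMeasure (μ k)] (s : κ) {G : (∀ k, α k) → ℝ}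
    (hG : Integrable G (Measure.pi μ)) :
    ∀ᵐ x ∂Measure.pi μ, Integrable (fun t => G (Function.update x s t)) (μ s) :=
  ((measurePreserving_update μ s).integrable_comp_of_integrable hG).prod_right_ae

/-- The standard Gaussian measure on `ℝ^κ`. -/
noncomputable abbrev gaussianPi (κ : Type*) [Fintype κ] : Measure (κ → ℝ) :=
  Measure.pi fun _ => gaussianReal 0 1

/-- **Stein's identity** in one coordinate of a standard Gaussian vector. -/
theorem integral_eval_mul_gaussianPi {κ : Type*} [Fintype κ] [DecidableEq κ] (s : κ)
    {G G' : (κ → ℝ) → ℝ}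
    (hd : ∀ x, HasDerivAt (fun t => G (Function.update x s t)) (G' x) (x s))
    (hi : Integrable G (gaussianPi κ)) (hsi : Integrable (fun x => x s * G x) (gaussianPi κ))
    (hi' : Integrable G' (gaussianPi κ)) :
    ∫ x, x s * G x ∂gaussianPi κ = ∫ x, G' x ∂gaussianPi κ := by
  rw [integral_pi_eq_integral_integral_update _ s hsi,
    integral_pi_eq_integral_integral_update _ s hi']
  refine integral_congr_ae ?_
  filter_upwards [ae_integrable_update _ s hi, ae_integrable_update _ s hsi,
    ae_integrable_update _ s hi'] with x h1 h2 h3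
  simp only [Function.update_self] at h2 ⊢
  refine integral_id_mul_gaussianReal (fun t => ?_) h1 h2 h3
  simpa using hd (Function.update x s t)

/-! ### Monomials in independent Gaussian variables -/

theorem prod_finset_eq_prod_univ_ite {κ : Type*} [Fintype κ] [DecidableEq κ] (S : Finset κ)
    (φ : ℝ → ℝ) (x : κ → ℝ) :
    ∏ s ∈ S, φ (x s) = ∏ s, if s ∈ S then φ (x s) else 1 := by
  rw [Finset.prod_ite_mem, Finset.univ_inter]

theorem integrable_prod_finset {κ : Type*} [Fintype κ] [DecidableEq κ] (S : Finset κ)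
    {φ : ℝ → ℝ} (hφ : Integrable φ (gaussianReal 0 1)) :
    Integrable (fun x : κ → ℝ => ∏ s ∈ S, φ (x s)) (gaussianPi κ) := by
  simp_rw [prod_finset_eq_prod_univ_ite]
  refine Integrable.fintype_prod (f := fun s t => if s ∈ S then φ t else 1) fun s => ?_
  by_cases hs : s ∈ S
  · simpa [hs] using hφ
  · simp [hs]

theorem integral_prod_finset {κ : Type*} [Fintype κ] [DecidableEq κ] (S : Finset κ) (φ : ℝ → ℝ) :
    ∫ x, ∏ s ∈ S, φ (x s) ∂gaussianPi κ = (∫ t, φ t ∂gaussianReal 0 1) ^ S.card := by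
  simp_rw [prod_finset_eq_prod_univ_ite]
  rw [integral_fintype_prod_eq_prod (fun s t => if s ∈ S then φ t else 1)]
  have : ∀ s, ∫ t, (if s ∈ S then φ t else 1) ∂gaussianReal 0 1
      = if s ∈ S then ∫ t, φ t ∂gaussianReal 0 1 else 1 := by
    intro s; split_ifs <;> simp
  simp [this]

theorem integrable_pow_gaussianReal (k : ℕ) :
    Integrable (fun t : ℝ => t ^ k) (gaussianReal 0 1) := by
  have h := (memLp_id_gaussianReal (μ := 0) (v := 1) (k : ℝ≥0)).integrable_norm_rpow'
  have h2 : Integrable (fun t : ℝ => ‖t‖ ^ k) (gaussianReal 0 1) := by simpa using h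
  exact h2.mono' (by fun_prop) (ae_of_all _ fun t => by simp)

/-! ### Smooth approximation of Lipschitz functions -/

/-- A Lipschitz function on a finite-dimensional space is a uniform limit of smooth functions with
the same Lipschitz constant whose derivatives are Lipschitz. -/
theorem exists_contDiff_lipschitz_approx {E : Type*} [NormedAddCommGroup E] [InnerProductSpace ℝ E]
    [FiniteDimensional ℝ E] [MeasurableSpace E] [BorelSpace E] {M : ℝ≥0} {g : E → ℝ}
    (hg : LipschitzWith M g) {ε : ℝ} (hε : 0 < ε) :
    ∃ f : E → ℝ, ContDiff ℝ 2 f ∧ LipschitzWith M f ∧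
      (∃ K : ℝ≥0, LipschitzWith K (fderiv ℝ f)) ∧ ∀ x, |f x - g x| ≤ ε := by
  have hr : 0 < ε / (M + 1) := by positivity
  -- With outer radius `ε / (M + 1)`, mollifying moves `g` by at most `M ε / (M + 1) ≤ ε`; the `+ 1`
  -- covers `M = 0`.
  let φ : ContDiffBump (0 : E) := ⟨ε / (M + 1) / 2, ε / (M + 1), by positivity, by linarith⟩
  set ψ := φ.normed (volume : Measure E) with hψ
  have hψc : HasCompactSupport ψ := φ.hasCompactSupport_normed
  have hψs : ContDiff ℝ (2 : ℕ∞) ψ := φ.contDiff_normed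
  have hgl : LocallyIntegrable g (volume : Measure E) := hg.continuous.locallyIntegrable
  have hψi : Integrable ψ := φ.integrable_normed
  set f : E → ℝ := convolution ψ g (ContinuousLinearMap.lsmul ℝ ℝ) volume with hf
  have hdψi : Integrable (fderiv ℝ ψ) :=
    (hψs.continuous_fderiv (by norm_num)).integrable_of_hasCompactSupport (hψc.fderiv ℝ)
  have hint : ∀ x, Integrable fun t => ψ t * g (x - t) := fun x =>
    (hψs.continuous.mul (hg.continuous.comp (by fun_prop))).integrable_of_hasCompactSupport
      hψc.mul_right
  have hdint : ∀ x, Integrable fun t => g (x - t) • fderiv ℝ ψ t := fun x =>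
    ((hg.continuous.comp (by fun_prop)).smul
      (hψs.continuous_fderiv (by norm_num))).integrable_of_hasCompactSupport
      (hψc.fderiv ℝ).smul_left
  -- The derivative falls on the bump, so increments of `fderiv ℝ f` are controlled by increments of
  -- `g` alone.
  have hdf : ∀ x, fderiv ℝ f x = ∫ t, g (x - t) • fderiv ℝ ψ t := by
    intro x
    rw [(hψc.hasFDerivAt_convolution_left (ContinuousLinearMap.lsmul ℝ ℝ)
      (hψs.of_le (by norm_num)) hgl x).fderiv, convolution_def]
    congr 1
    ext t v
    simp [ContinuousLinearMap.precompL_apply, mul_comm]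
  have hd : ∀ x y t, |g (x - t) - g (y - t)| ≤ M * ‖x - y‖ := fun x y t => by
    have := hg.norm_sub_le (x - t) (y - t)
    simpa using this
  obtain ⟨N, hN⟩ : ∃ N : ℝ≥0, (N : ℝ) = ∫ t, ‖fderiv ℝ ψ t‖ :=
    ⟨⟨_, integral_nonneg fun _ => norm_nonneg _⟩, rfl⟩
  refine ⟨f, ?_, ?_, ⟨M * N, ?_⟩, ?_⟩
  · exact_mod_cast hψc.contDiff_convolution_left (ContinuousLinearMap.lsmul ℝ ℝ) hψs hgl
  · refine LipschitzWith.of_dist_le_mul fun x y => ?_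
    rw [dist_eq_norm, dist_eq_norm, hf, convolution_def, convolution_def]
    simp only [ContinuousLinearMap.lsmul_apply, smul_eq_mul]
    rw [← integral_sub (hint x) (hint y)]
    calc _ ≤ ∫ t, ψ t * (M * ‖x - y‖) := by
          refine norm_integral_le_of_norm_le (hψi.mul_const _) (ae_of_all _ fun t => ?_)
          rw [← mul_sub, norm_mul, Real.norm_of_nonneg (φ.nonneg_normed t)]
          exact mul_le_mul_of_nonneg_left (hd x y t) (φ.nonneg_normed t)
      _ = _ := by rw [integral_mul_const, φ.integral_normed, one_mul]
  · refine LipschitzWith.of_dist_le_mul fun x y => ?_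
    rw [dist_eq_norm, dist_eq_norm, hdf, hdf, ← integral_sub (hdint x) (hdint y)]
    calc _ ≤ ∫ t, (M * ‖x - y‖) * ‖fderiv ℝ ψ t‖ := by
          refine norm_integral_le_of_norm_le (hdψi.norm.const_mul _) (ae_of_all _ fun t => ?_)
          rw [← sub_smul, norm_smul]
          exact mul_le_mul_of_nonneg_right (hd x y t) (norm_nonneg _)
      _ = _ := by rw [integral_const_mul, ← hN, NNReal.coe_mul]; ring
  · intro x
    rw [← Real.dist_eq]
    refine φ.dist_normed_convolution_le hg.continuous.aestronglyMeasurable fun y hy => ?_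
    refine (hg.dist_le_mul y x).trans ?_
    have : dist y x < ε / (M + 1) := hy
    calc (M : ℝ) * dist y x ≤ (M + 1) * (ε / (M + 1)) := by gcongr; linarith
      _ = ε := by field_simp

/-! ### Stein kernels and the distance to a Gaussian vector -/

/-- `τ` is a Stein kernel of the random vector `F`: `E[F_a h(F)] = ∑_b E[τ_{ab} ∂_b h(F)]` for all
bounded continuously differentiable `h` with bounded derivative. -/
structure IsSteinKernel {Ω : Type*} [MeasurableSpace Ω] (μ : Measure Ω) {ι : Type*} [Fintype ι]
    [DecidableEq ι] (F : Ω → EuclideanSpace ℝ ι) (τ : ι → ι → Ω → ℝ) : Prop where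
  integrable : Integrable F μ
  memLp : ∀ a b, MemLp (τ a b) 2 μ
  integral_mul : ∀ h : EuclideanSpace ℝ ι → ℝ, ContDiff ℝ 1 h → (∃ K, ∀ y, |h y| ≤ K) →
    (∃ K, ∀ y, ‖fderiv ℝ h y‖ ≤ K) → ∀ a,
    ∫ ω, F ω a * h (F ω) ∂μ
      = ∑ b, ∫ ω, τ a b ω * fderiv ℝ h (F ω) (EuclideanSpace.single b 1) ∂μ

theorem ContinuousLinearMap.apply_eq_sum_single {ι : Type*} [Fintype ι] [DecidableEq ι]
    (ℓ : EuclideanSpace ℝ ι →L[ℝ] ℝ) (v : EuclideanSpace ℝ ι) :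
    ℓ v = ∑ a, v a * ℓ (EuclideanSpace.single a 1) := by
  conv_lhs => rw [← (EuclideanSpace.basisFun ι ℝ).sum_repr v, map_sum]
  simp

theorem integrable_eval_gaussianPi {κ : Type*} [Fintype κ] (b : κ) :
    Integrable (fun z : κ → ℝ => z b) (gaussianPi κ) := by
  classical
  simpa using integrable_prod_finset {b} (by simpa using integrable_pow_gaussianReal 1)

theorem integral_sq_gaussianReal : ∫ t, t * t ∂gaussianReal 0 1 = 1 := by
  have := integral_id_mul_gaussianReal (h := fun t => t) (h' := fun _ => 1)
    (fun t => hasDerivAt_id t) (by simpa using integrable_pow_gaussianReal 1)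
    (by simpa [pow_two] using integrable_pow_gaussianReal 2) (integrable_const _)
  simpa using this

theorem integrable_eval_mul_eval_gaussianPi {κ : Type*} [Fintype κ] (b b' : κ) :
    Integrable (fun z : κ → ℝ => z b * z b') (gaussianPi κ) := by
  classical
  rcases eq_or_ne b b' with rfl | h
  · simpa using integrable_prod_finset {b} (φ := fun t => t * t)
      (by simpa [pow_two] using integrable_pow_gaussianReal 2)
  · simpa [Finset.prod_pair h] using integrable_prod_finset {b, b'} (φ := fun t => t)
      (by simpa using integrable_pow_gaussianReal 1)

theorem integral_eval_mul_eval_gaussianPi {κ : Type*} [Fintype κ] [DecidableEq κ] (b b' : κ) :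
    ∫ z, z b * z b' ∂gaussianPi κ = if b = b' then 1 else 0 := by
  rcases eq_or_ne b b' with rfl | h
  · simpa [integral_sq_gaussianReal] using integral_prod_finset {b} (fun t => t * t)
  · simpa [Finset.prod_pair h, h] using integral_prod_finset {b, b'} (fun t => t)

theorem sq_integral_le_integral_sq {Ω : Type*} [MeasurableSpace Ω] {μ : Measure Ω}
    [IsProbabilityMeasure μ] {G : Ω → ℝ} (hG : MemLp G 2 μ) :
    (∫ ω, G ω ∂μ) ^ 2 ≤ ∫ ω, G ω ^ 2 ∂μ := by
  have h := variance_nonneg G μ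
  rw [variance_eq_sub hG] at h
  simpa using h

section SteinKernel

variable {Ω : Type*} [MeasurableSpace Ω] {μ : Measure Ω} {ι : Type*}
  [Fintype ι] {F : Ω → EuclideanSpace ℝ ι} {τ : ι → ι → Ω → ℝ}

theorem aestronglyMeasurable_comp_interpolation (hF : AEStronglyMeasurable F μ) {Y : Type*}
    [TopologicalSpace Y] [TopologicalSpace.PseudoMetrizableSpace Y]
    {h : EuclideanSpace ℝ ι → Y} (hh : Continuous h) (s c : ℝ) :
    AEStronglyMeasurable (fun q : Ω × (ι → ℝ) => h (s • F q.1 + c • WithLp.toLp 2 q.2))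
      (μ.prod (gaussianPi ι)) := by
  refine hh.comp_aestronglyMeasurable ((hF.comp_fst.const_smul s).add ?_)
  exact ((PiLp.continuous_toLp 2 _).measurable.comp
    measurable_snd).aestronglyMeasurable.const_smul c

variable [IsProbabilityMeasure μ] [DecidableEq ι]

/-- With the Gaussian variable frozen at `z`, this is the Stein kernel identity for `y ↦ h (s y + c
z)`; the chain rule supplies the factor `s`. -/
theorem integral_mul_interpolation_fst (hτ : IsSteinKernel μ F τ) {h : EuclideanSpace ℝ ι → ℝ}
    (hh : ContDiff ℝ 1 h) {K K' : ℝ} (hK : ∀ y, |h y| ≤ K) (hK' : ∀ y, ‖fderiv ℝ h y‖ ≤ K')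
    (s c : ℝ) (a : ι) :
    ∫ q, F q.1 a * h (s • F q.1 + c • WithLp.toLp 2 q.2) ∂μ.prod (gaussianPi ι)
      = s * ∑ b, ∫ q, τ a b q.1 * fderiv ℝ h (s • F q.1 + c • WithLp.toLp 2 q.2)
        (EuclideanSpace.single b 1) ∂μ.prod (gaussianPi ι) := by
  have hFm := hτ.integrable.1
  have hFa : Integrable (fun ω => F ω a) μ :=
    (EuclideanSpace.proj (𝕜 := ℝ) a).integrable_comp hτ.integrable
  have hd1 : Continuous fun y => fderiv ℝ h y := hh.continuous_fderiv one_ne_zero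
  have hi1 : Integrable (fun q : Ω × (ι → ℝ) =>
      F q.1 a * h (s • F q.1 + c • WithLp.toLp 2 q.2)) (μ.prod (gaussianPi ι)) :=
    (hFa.comp_fst _).mul_bdd (c := K)
      (aestronglyMeasurable_comp_interpolation hFm hh.continuous s c)
      (ae_of_all _ fun q => hK _)
  have hi2 : ∀ b, Integrable (fun q : Ω × (ι → ℝ) =>
      τ a b q.1 * fderiv ℝ h (s • F q.1 + c • WithLp.toLp 2 q.2) (EuclideanSpace.single b 1))
      (μ.prod (gaussianPi ι)) := fun b => by
    refine (((hτ.memLp a b).integrable (by norm_num)).comp_fst _).mul_bdd (c := K')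
      (aestronglyMeasurable_comp_interpolation hFm
        (h := fun y => fderiv ℝ h y (EuclideanSpace.single b 1)) (by fun_prop) s c)
      (ae_of_all _ fun q => ?_)
    refine (ContinuousLinearMap.le_opNorm _ _).trans ?_
    simpa using hK' _
  rw [integral_prod_symm _ hi1]
  simp_rw [fun b => integral_prod_symm _ (hi2 b)]
  rw [← integral_finsetSum _ fun b _ => (hi2 b).integral_prod_right, ← integral_const_mul]
  refine integral_congr_ae (ae_of_all _ fun z => ?_)
  dsimp only
  have haff : ∀ y, HasFDerivAt (fun y : EuclideanSpace ℝ ι => s • y + c • WithLp.toLp 2 z)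
      (s • ContinuousLinearMap.id ℝ _) y := fun y =>
    ((hasFDerivAt_id y).const_smul s).add_const _
  have hder : ∀ y, fderiv ℝ (fun y => h (s • y + c • WithLp.toLp 2 z)) y
      = s • fderiv ℝ h (s • y + c • WithLp.toLp 2 z) := fun y => by
    refine (((hh.differentiable one_ne_zero _).hasFDerivAt).comp y (haff y)).fderiv.trans ?_
    ext v; simp
  rw [hτ.integral_mul (fun y => h (s • y + c • WithLp.toLp 2 z)) (hh.comp (by fun_prop))
    ⟨K, fun y => hK _⟩ ⟨|s| * K', fun y => ?_⟩ a, Finset.mul_sum]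
  · refine Finset.sum_congr rfl fun b _ => ?_
    rw [← integral_const_mul]
    congr 1
    ext ω
    rw [hder]
    simp; ring
  · rw [hder, norm_smul]
    exact mul_le_mul_of_nonneg_left (hK' _) (abs_nonneg s)

/-- Stein's identity in `z_b` with `ω` frozen. The weight `w` permits two uses: `w = 1` for the
Gaussian part of the derivative, and `w = τ_{ab} - δ_{ab}` to remove second derivatives. -/
theorem integral_mul_interpolation_snd (hF : AEStronglyMeasurable F μ) {w : Ω → ℝ}
    (hw : Integrable w μ) {h : EuclideanSpace ℝ ι → ℝ}
    (hh : ContDiff ℝ 1 h) {K K' : ℝ} (hK : ∀ y, |h y| ≤ K) (hK' : ∀ y, ‖fderiv ℝ h y‖ ≤ K')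
    (s c : ℝ) (b : ι) :
    ∫ q, w q.1 * q.2 b * h (s • F q.1 + c • WithLp.toLp 2 q.2) ∂μ.prod (gaussianPi ι)
      = c * ∫ q, w q.1 * fderiv ℝ h (s • F q.1 + c • WithLp.toLp 2 q.2)
        (EuclideanSpace.single b 1) ∂μ.prod (gaussianPi ι) := by
  have hd1 : Continuous fun y => fderiv ℝ h y := hh.continuous_fderiv one_ne_zero
  have hK1 : ∀ y, ‖fderiv ℝ h y (EuclideanSpace.single b 1)‖ ≤ K' := fun y => by
    refine (ContinuousLinearMap.le_opNorm _ _).trans ?_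
    simpa using hK' y
  have hi1 : Integrable (fun q : Ω × (ι → ℝ) =>
      w q.1 * q.2 b * h (s • F q.1 + c • WithLp.toLp 2 q.2)) (μ.prod (gaussianPi ι)) :=
    (hw.mul_prod (integrable_eval_gaussianPi b)).mul_bdd (c := K)
      (aestronglyMeasurable_comp_interpolation hF hh.continuous s c)
      (ae_of_all _ fun q => hK _)
  have hi2 : Integrable (fun q : Ω × (ι → ℝ) =>
      w q.1 * fderiv ℝ h (s • F q.1 + c • WithLp.toLp 2 q.2) (EuclideanSpace.single b 1))
      (μ.prod (gaussianPi ι)) :=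
    (hw.comp_fst _).mul_bdd (c := K')
      (aestronglyMeasurable_comp_interpolation hF
        (h := fun y => fderiv ℝ h y (EuclideanSpace.single b 1)) (by fun_prop) s c)
      (ae_of_all _ fun q => hK1 _)
  rw [integral_prod _ hi1, integral_prod _ hi2, ← integral_const_mul]
  refine integral_congr_ae (ae_of_all _ fun ω => ?_)
  dsimp only
  have hcont : Continuous fun z : ι → ℝ => s • F ω + c • WithLp.toLp 2 z :=
    continuous_const.add ((PiLp.continuous_toLp 2 _).const_smul c)
  have key := integral_eval_mul_gaussianPi b
    (G := fun z : ι → ℝ => h (s • F ω + c • WithLp.toLp 2 z))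
    (G' := fun z => c * fderiv ℝ h (s • F ω + c • WithLp.toLp 2 z) (EuclideanSpace.single b 1))
    (fun z => ?_) ?_ ?_ ?_
  · simp_rw [mul_assoc]
    rw [integral_const_mul, key, integral_const_mul, integral_const_mul]
    ring
  · have hl : HasDerivAt (fun t => s • F ω + c • WithLp.toLp 2 (Function.update z b t))
        (c • EuclideanSpace.single b (1 : ℝ)) (z b) := by
      have h1 : HasDerivAt (fun t => Function.update z b t) (Pi.single b 1) (z b) :=
        hasDerivAt_update z b (z b)
      have h2 := (PiLp.continuousLinearEquiv 2 ℝ (fun _ : ι => ℝ)).symm.hasFDerivAt.comp_hasDerivAt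
        (z b) h1
      exact (h2.const_smul c).const_add _
    have := (hh.differentiable one_ne_zero
      (s • F ω + c • WithLp.toLp 2 (Function.update z b (z b)))).hasFDerivAt.comp_hasDerivAt
      (z b) hl
    simpa [Function.comp_def] using this
  · exact Integrable.of_bound (hh.continuous.comp hcont).aestronglyMeasurable K
      (ae_of_all _ fun z => hK _)
  · exact (integrable_eval_gaussianPi b).mul_bdd (c := K)
      (hh.continuous.comp hcont).aestronglyMeasurable (ae_of_all _ fun z => hK _)
  · refine Integrable.const_mul (Integrable.of_bound (Continuous.aestronglyMeasurable ?_) K'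
      (ae_of_all _ fun z => hK1 _)) c
    exact (hd1.comp hcont).clm_apply continuous_const

/-- The squared `L²` distance between a Stein kernel and the identity matrix. -/
noncomputable def steinDiscrepancySq (μ : Measure Ω) (τ : ι → ι → Ω → ℝ) : ℝ :=
  ∑ a, ∑ b, ∫ ω, (τ a b ω - if a = b then 1 else 0) ^ 2 ∂μ

omit [DecidableEq ι] in
-- For an independent standard Gaussian `z`, the mean of `|A z|²` is the Hilbert–Schmidt norm: the
-- cross terms vanish because `E[z_b z_b'] = δ_{bb'}`.
theorem integral_sum_sq_mul_eval {A : ι → ι → Ω → ℝ} (hA : ∀ a b, MemLp (A a b) 2 μ) :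
    Integrable (fun q : Ω × (ι → ℝ) => ∑ a, (∑ b, A a b q.1 * q.2 b) ^ 2)
      (μ.prod (gaussianPi ι)) ∧
    ∫ q, ∑ a, (∑ b, A a b q.1 * q.2 b) ^ 2 ∂μ.prod (gaussianPi ι)
      = ∑ a, ∑ b, ∫ ω, A a b ω ^ 2 ∂μ := by
  classical
  have hi : ∀ a b b', Integrable (fun q : Ω × (ι → ℝ) =>
      (A a b q.1 * A a b' q.1) * (q.2 b * q.2 b')) (μ.prod (gaussianPi ι)) := fun a b b' =>
    ((hA a b).integrable_mul (hA a b')).mul_prod (integrable_eval_mul_eval_gaussianPi b b')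
  have heq : ∀ q : Ω × (ι → ℝ), ∑ a, (∑ b, A a b q.1 * q.2 b) ^ 2
      = ∑ a, ∑ b, ∑ b', (A a b q.1 * A a b' q.1) * (q.2 b * q.2 b') := fun q => by
    refine Finset.sum_congr rfl fun a _ => ?_
    rw [pow_two, Finset.sum_mul_sum]
    exact Finset.sum_congr rfl fun b _ => Finset.sum_congr rfl fun b' _ => by ring
  simp_rw [heq]
  refine ⟨integrable_finsetSum _ fun a _ => integrable_finsetSum _ fun b _ =>
    integrable_finsetSum _ fun b' _ => hi a b b', ?_⟩
  rw [integral_finsetSum _ fun a _ => integrable_finsetSum _ fun b _ =>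
    integrable_finsetSum _ fun b' _ => hi a b b']
  refine Finset.sum_congr rfl fun a _ => ?_
  rw [integral_finsetSum _ fun b _ => integrable_finsetSum _ fun b' _ => hi a b b']
  refine Finset.sum_congr rfl fun b _ => ?_
  rw [integral_finsetSum _ fun b' _ => hi a b b']
  simp_rw [fun b' => integral_prod_mul (μ := μ) (ν := gaussianPi ι)
    (fun ω => A a b ω * A a b' ω) (fun z => z b * z b'), integral_eval_mul_eval_gaussianPi]
  simp [pow_two]

/-- Integrating by parts in `F` and in `Z` leaves `s c E⟨τ - I, Hess f(U)⟩`. A reverse integration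
by parts in `Z` absorbs `c` and one derivative, and Cauchy–Schwarz finishes. Hence `K` serves only
integrability and is absent from the bound. -/
theorem abs_integral_deriv_interpolation_le (hτ : IsSteinKernel μ F τ)
    {f : EuclideanSpace ℝ ι → ℝ} (hf : ContDiff ℝ 2 f) {M K : ℝ≥0} (hM : LipschitzWith M f)
    (hK : LipschitzWith K (fderiv ℝ f)) (s c : ℝ) :
    |∫ q, fderiv ℝ f (s • F q.1 + c • WithLp.toLp 2 q.2)
        (c • F q.1 - s • WithLp.toLp 2 q.2) ∂μ.prod (gaussianPi ι)|
      ≤ |s| * (M * √(steinDiscrepancySq μ τ)) := by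
  set U : Ω × (ι → ℝ) → EuclideanSpace ℝ ι := fun q => s • F q.1 + c • WithLp.toLp 2 q.2 with hU
  set H : ι → EuclideanSpace ℝ ι → ℝ := fun a y => fderiv ℝ f y (EuclideanSpace.single a 1) with hH
  set A : ι → ι → Ω → ℝ := fun a b ω => τ a b ω - if a = b then 1 else 0 with hA
  have hfd : ContDiff ℝ 1 (fderiv ℝ f) := hf.fderiv_right (by norm_num)
  have hHc : ∀ a, ContDiff ℝ 1 (H a) := fun a => hfd.clm_apply contDiff_const
  have hMf : ∀ y, ‖fderiv ℝ f y‖ ≤ M := fun y => norm_fderiv_le_of_lipschitz ℝ hM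
  have hHM : ∀ a y, |H a y| ≤ M := fun a y => by
    rw [← Real.norm_eq_abs]
    refine ((fderiv ℝ f y).le_opNorm _).trans ?_
    simpa using hMf y
  have hHK : ∀ a y, ‖fderiv ℝ (H a) y‖ ≤ K := fun a y => by
    refine norm_fderiv_le_of_lipschitz ℝ (LipschitzWith.of_dist_le_mul fun x y => ?_)
    rw [dist_eq_norm, dist_eq_norm]
    refine ((fderiv ℝ f x - fderiv ℝ f y).le_opNorm (EuclideanSpace.single a 1)).trans ?_
    simpa using hK.norm_sub_le x y
  have hFm := hτ.integrable.1
  have hFa : ∀ a, Integrable (fun ω => F ω a) μ := fun a =>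
    (EuclideanSpace.proj (𝕜 := ℝ) a).integrable_comp hτ.integrable
  have hAm : ∀ a b, MemLp (A a b) 2 μ := fun a b => (hτ.memLp a b).sub (memLp_const _)
  have hAi : ∀ a b, Integrable (A a b) μ := fun a b => (hAm a b).integrable (by norm_num)
  have hτi : ∀ a b, Integrable (τ a b) μ := fun a b => (hτ.memLp a b).integrable (by norm_num)
  have hHU : ∀ a, AEStronglyMeasurable (fun q => H a (U q)) (μ.prod (gaussianPi ι)) := fun a =>
    aestronglyMeasurable_comp_interpolation hFm (hHc a).continuous s c
  have hdHU : ∀ a b, AEStronglyMeasurable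
      (fun q => fderiv ℝ (H a) (U q) (EuclideanSpace.single b 1)) (μ.prod (gaussianPi ι)) :=
    fun a b => by
      have := (hHc a).continuous_fderiv one_ne_zero
      exact aestronglyMeasurable_comp_interpolation hFm
        (h := fun y => fderiv ℝ (H a) y (EuclideanSpace.single b 1)) (by fun_prop) s c
  have i1 : ∀ a, Integrable (fun q : Ω × (ι → ℝ) => F q.1 a * H a (U q)) (μ.prod (gaussianPi ι)) :=
    fun a => ((hFa a).comp_fst _).mul_bdd (c := M) (hHU a) (ae_of_all _ fun q => hHM a _)
  have i2 : ∀ a, Integrable (fun q : Ω × (ι → ℝ) => 1 * q.2 a * H a (U q))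
      (μ.prod (gaussianPi ι)) := fun a =>
    (((integrable_const (1 : ℝ)).mul_prod (integrable_eval_gaussianPi a))).mul_bdd (c := M)
      (hHU a) (ae_of_all _ fun q => hHM a _)
  have i3 : ∀ w : Ω → ℝ, Integrable w μ → ∀ a b, Integrable (fun q : Ω × (ι → ℝ) =>
      w q.1 * fderiv ℝ (H a) (U q) (EuclideanSpace.single b 1)) (μ.prod (gaussianPi ι)) :=
    fun w hw a b => (hw.comp_fst _).mul_bdd (c := K) (hdHU a b) (ae_of_all _ fun q =>
      (ContinuousLinearMap.le_opNorm _ _).trans (by simpa using hHK a (U q)))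
  have i4 : ∀ a b, Integrable (fun q : Ω × (ι → ℝ) => A a b q.1 * q.2 b * H a (U q))
      (μ.prod (gaussianPi ι)) := fun a b =>
    ((hAi a b).mul_prod (integrable_eval_gaussianPi b)).mul_bdd (c := M)
      (hHU a) (ae_of_all _ fun q => hHM a _)
  have i5 : ∀ a, Integrable (fun q : Ω × (ι → ℝ) =>
      c * (F q.1 a * H a (U q)) - s * (1 * q.2 a * H a (U q))) (μ.prod (gaussianPi ι)) :=
    fun a => ((i1 a).const_mul c).sub ((i2 a).const_mul s)
  set D : ι → ι → ℝ := fun a b =>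
    ∫ q, A a b q.1 * fderiv ℝ (H a) (U q) (EuclideanSpace.single b 1) ∂μ.prod (gaussianPi ι)
  have hLHS : ∫ q, fderiv ℝ f (U q) (c • F q.1 - s • WithLp.toLp 2 q.2) ∂μ.prod (gaussianPi ι)
      = s * ∑ a, ∑ b, c * D a b := by
    have h1 : ∀ q : Ω × (ι → ℝ), fderiv ℝ f (U q) (c • F q.1 - s • WithLp.toLp 2 q.2)
        = ∑ a, (c * (F q.1 a * H a (U q)) - s * (1 * q.2 a * H a (U q))) := fun q => by
      rw [ContinuousLinearMap.apply_eq_sum_single]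
      refine Finset.sum_congr rfl fun a _ => ?_
      simp [hH]; ring
    simp_rw [h1]
    rw [integral_finsetSum _ fun a _ => i5 a, Finset.mul_sum]
    refine Finset.sum_congr rfl fun a _ => ?_
    rw [integral_sub ((i1 a).const_mul c) ((i2 a).const_mul s), integral_const_mul,
      integral_const_mul,
      integral_mul_interpolation_fst hτ (hHc a) (hHM a) (hHK a) s c a,
      integral_mul_interpolation_snd hFm (integrable_const (1 : ℝ)) (hHc a) (hHM a) (hHK a) s c a,
      ← Finset.mul_sum]
    have h2 : ∀ b, D a b
        = (∫ q, τ a b q.1 * fderiv ℝ (H a) (U q) (EuclideanSpace.single b 1)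
            ∂μ.prod (gaussianPi ι))
          - if a = b then ∫ q, 1 * fderiv ℝ (H a) (U q) (EuclideanSpace.single a 1)
            ∂μ.prod (gaussianPi ι) else 0 := fun b => by
      have : ∀ q : Ω × (ι → ℝ), A a b q.1 * fderiv ℝ (H a) (U q) (EuclideanSpace.single b 1)
          = τ a b q.1 * fderiv ℝ (H a) (U q) (EuclideanSpace.single b 1)
            - (if a = b then 1 else 0) * fderiv ℝ (H a) (U q) (EuclideanSpace.single b 1) :=
        fun q => by simp only [hA]; ring
      simp only [D]
      simp_rw [this]
      rw [integral_sub (i3 _ (hτi a b) a b) (i3 _ (integrable_const _) a b)]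
      split_ifs with hab
      · rw [hab]
      · simp
    simp_rw [h2]
    rw [Finset.sum_sub_distrib]
    simp only [Finset.sum_ite_eq, Finset.mem_univ, if_true]
    simp only [hU]
    ring
  -- Stein's identity read backwards: the second derivative is traded for a factor `z_b`. Nothing is
  -- divided by `c`, so `c = 0` is allowed.
  have hDe : ∀ a b, c * D a b
      = ∫ q, A a b q.1 * q.2 b * H a (U q) ∂μ.prod (gaussianPi ι) := fun a b =>
    (integral_mul_interpolation_snd hFm (hAi a b) (hHc a) (hHM a) (hHK a) s c b).symm
  rw [hLHS, abs_mul]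
  refine mul_le_mul_of_nonneg_left ?_ (abs_nonneg s)
  simp_rw [hDe]
  simp_rw [← fun a => integral_finsetSum Finset.univ fun b _ => i4 a b]
  rw [← integral_finsetSum _ fun a _ => integrable_finsetSum _ fun b _ => i4 a b]
  obtain ⟨hq, hqe⟩ := integral_sum_sq_mul_eval hAm
  -- For fixed `q` the double sum is `fderiv ℝ f` applied to the vector `A z`, hence at most `M |A
  -- z|` in absolute value.
  have hpt : ∀ q : Ω × (ι → ℝ), (∑ a, ∑ b, A a b q.1 * q.2 b * H a (U q)) ^ 2
      ≤ M ^ 2 * ∑ a, (∑ b, A a b q.1 * q.2 b) ^ 2 := fun q => by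
    set v : EuclideanSpace ℝ ι := WithLp.toLp 2 fun a => ∑ b, A a b q.1 * q.2 b with hv
    have e1 : ∑ a, ∑ b, A a b q.1 * q.2 b * H a (U q) = fderiv ℝ f (U q) v := by
      rw [ContinuousLinearMap.apply_eq_sum_single]
      exact Finset.sum_congr rfl fun a _ => by simp only [hv, Finset.sum_mul, hH]
    have e2 : ∑ a, (∑ b, A a b q.1 * q.2 b) ^ 2 = ‖v‖ ^ 2 := by
      simp [EuclideanSpace.norm_sq_eq, hv]
    rw [e1, e2, ← mul_pow, ← sq_abs]
    have := ((fderiv ℝ f (U q)).le_opNorm v).trans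
      (mul_le_mul_of_nonneg_right (hMf (U q)) (norm_nonneg v))
    exact pow_le_pow_left₀ (abs_nonneg _) this 2
  have hGm : MemLp (fun q : Ω × (ι → ℝ) => ∑ a, ∑ b, A a b q.1 * q.2 b * H a (U q)) 2
      (μ.prod (gaussianPi ι)) := by
    have hmeas := (integrable_finsetSum Finset.univ fun a _ =>
      integrable_finsetSum Finset.univ fun b _ => i4 a b).1
    refine (memLp_two_iff_integrable_sq hmeas).2 ((hq.const_mul (M ^ 2 : ℝ)).mono'
      (hmeas.pow 2) (ae_of_all _ fun q => ?_))
    rw [Real.norm_of_nonneg (sq_nonneg _)]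
    exact hpt q
  have hfin : (∫ q, ∑ a, ∑ b, A a b q.1 * q.2 b * H a (U q) ∂μ.prod (gaussianPi ι)) ^ 2
      ≤ M ^ 2 * steinDiscrepancySq μ τ := by
    refine (sq_integral_le_integral_sq hGm).trans ?_
    rw [steinDiscrepancySq, ← hqe, ← integral_const_mul]
    exact integral_mono hGm.integrable_sq (hq.const_mul _) hpt
  refine (Real.abs_le_sqrt hfin).trans (le_of_eq ?_)
  rw [Real.sqrt_mul (by positivity), Real.sqrt_sq M.coe_nonneg]

omit [IsProbabilityMeasure μ] in
theorem integrable_toLp {v : Ω → ι → ℝ} (hv : ∀ a, Integrable (fun ω => v ω a) μ) :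
    Integrable (fun ω => (WithLp.toLp 2 (v ω) : EuclideanSpace ℝ ι)) μ := by
  have : (fun ω => (WithLp.toLp 2 (v ω) : EuclideanSpace ℝ ι))
      = fun ω => ∑ a, v ω a • EuclideanSpace.single a (1 : ℝ) := by
    ext z a
    simp [Pi.single_apply]
  rw [this]
  exact integrable_finsetSum _ fun a _ => (hv a).smul_const _

theorem integrable_toLp_gaussianPi :
    Integrable (fun z : ι → ℝ => (WithLp.toLp 2 z : EuclideanSpace ℝ ι)) (gaussianPi ι) :=
  integrable_toLp fun a => integrable_eval_gaussianPi a

theorem LipschitzWith.integrable_comp_of_integrable {α E : Type*} [MeasurableSpace α]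
    {ν : Measure α} [IsFiniteMeasure ν] [NormedAddCommGroup E] {g : E → ℝ} {M : ℝ≥0}
    (hg : LipschitzWith M g) {V : α → E} (hV : Integrable V ν) :
    Integrable (fun x => g (V x)) ν := by
  refine ((hV.norm.const_mul (M : ℝ)).add (integrable_const |g 0|)).mono'
    (hg.continuous.comp_aestronglyMeasurable hV.1) (ae_of_all _ fun x => ?_)
  have h := hg.norm_sub_le (V x) 0
  rw [sub_zero] at h
  have := norm_sub_norm_le (g (V x)) (g 0)
  simp only [Pi.add_apply]
  rw [← Real.norm_eq_abs]
  linarith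

theorem abs_integral_comp_sub_le {α E : Type*} [MeasurableSpace α]
    {ν : Measure α} [IsProbabilityMeasure ν] [NormedAddCommGroup E] {f g : E → ℝ} {M M' : ℝ≥0}
    (hg : LipschitzWith M g) (hf : LipschitzWith M' f) {ε : ℝ} (hfg : ∀ x, |f x - g x| ≤ ε)
    {V : α → E} (hV : Integrable V ν) :
    |∫ x, g (V x) ∂ν - ∫ x, f (V x) ∂ν| ≤ ε := by
  rw [← integral_sub (hg.integrable_comp_of_integrable hV) (hf.integrable_comp_of_integrable hV)]
  have := norm_integral_le_of_norm_le_const (μ := ν) (C := ε)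
    (f := fun x => g (V x) - f (V x))
    (ae_of_all _ fun x => by rw [Real.norm_eq_abs, abs_sub_comm]; exact hfg _)
  simpa using this

/-- The trigonometric path has velocity bounded by `‖F‖ + ‖Z‖` uniformly in `θ`, so one integrable
bound dominates everywhere, endpoints included. -/
theorem hasDerivAt_integral_interpolation (hF : Integrable F μ)
    {f : EuclideanSpace ℝ ι → ℝ} (hf : ContDiff ℝ 1 f) {M : ℝ≥0} (hM : LipschitzWith M f) (θ : ℝ) :
    HasDerivAt (fun θ => ∫ q, f (Real.sin θ • F q.1 + Real.cos θ • WithLp.toLp 2 q.2)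
        ∂μ.prod (gaussianPi ι))
      (∫ q, fderiv ℝ f (Real.sin θ • F q.1 + Real.cos θ • WithLp.toLp 2 q.2)
        (Real.cos θ • F q.1 - Real.sin θ • WithLp.toLp 2 q.2) ∂μ.prod (gaussianPi ι)) θ := by
  have hZ : Integrable (fun q : Ω × (ι → ℝ) => (WithLp.toLp 2 q.2 : EuclideanSpace ℝ ι))
    (μ.prod (gaussianPi ι)) := integrable_toLp_gaussianPi.comp_snd μ
  have hFi : Integrable (fun q : Ω × (ι → ℝ) => F q.1) (μ.prod (gaussianPi ι)) :=
    hF.comp_fst _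
  have hVi : ∀ θ, Integrable (fun q : Ω × (ι → ℝ) =>
      Real.sin θ • F q.1 + Real.cos θ • WithLp.toLp 2 q.2) (μ.prod (gaussianPi ι)) := fun θ =>
    (hFi.smul (Real.sin θ)).add (hZ.smul (Real.cos θ))
  have hWi : Integrable (fun q : Ω × (ι → ℝ) =>
      Real.cos θ • F q.1 - Real.sin θ • WithLp.toLp 2 q.2) (μ.prod (gaussianPi ι)) :=
    (hFi.smul (Real.cos θ)).sub (hZ.smul (Real.sin θ))
  have hfd : Continuous (fderiv ℝ f) := hf.continuous_fderiv one_ne_zero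
  refine (hasDerivAt_integral_of_dominated_loc_of_deriv_le
    (F := fun θ (q : Ω × (ι → ℝ)) => f (Real.sin θ • F q.1 + Real.cos θ • WithLp.toLp 2 q.2))
    (F' := fun θ (q : Ω × (ι → ℝ)) => fderiv ℝ f
      (Real.sin θ • F q.1 + Real.cos θ • WithLp.toLp 2 q.2)
      (Real.cos θ • F q.1 - Real.sin θ • WithLp.toLp 2 q.2))
    (bound := fun q => M * (‖F q.1‖ + ‖(WithLp.toLp 2 q.2 : EuclideanSpace ℝ ι)‖))
    (s := Set.univ) univ_mem ?_ ?_ ?_ ?_ ?_ ?_).2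
  · exact Eventually.of_forall fun θ => (hM.integrable_comp_of_integrable (hVi θ)).1
  · exact hM.integrable_comp_of_integrable (hVi θ)
  · exact (isBoundedBilinearMap_apply (𝕜 := ℝ)).continuous.comp_aestronglyMeasurable
      ((hfd.comp_aestronglyMeasurable (hVi θ).1).prodMk hWi.1)
  · refine ae_of_all _ fun q θ _ => ?_
    refine (ContinuousLinearMap.le_opNorm _ _).trans ?_
    refine mul_le_mul (norm_fderiv_le_of_lipschitz ℝ hM) ?_ (norm_nonneg _) M.coe_nonneg
    refine (norm_sub_le _ _).trans ?_
    rw [norm_smul, norm_smul]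
    refine add_le_add ?_ ?_
    · exact mul_le_of_le_one_left (norm_nonneg _) (Real.abs_cos_le_one θ)
    · exact mul_le_of_le_one_left (norm_nonneg _) (Real.abs_sin_le_one θ)
  · exact (hFi.norm.add hZ.norm).const_mul _
  · refine ae_of_all _ fun q θ _ => ?_
    have h1 : HasDerivAt (fun θ => Real.sin θ • F q.1 + Real.cos θ • WithLp.toLp 2 q.2)
        (Real.cos θ • F q.1 - Real.sin θ • WithLp.toLp 2 q.2) θ := by
      rw [sub_eq_add_neg, ← neg_smul]
      exact ((Real.hasDerivAt_sin θ).smul_const _).add ((Real.hasDerivAt_cos θ).smul_const _)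
    exact (hf.differentiable one_ne_zero _).hasFDerivAt.comp_hasDerivAt θ h1

/-- The path runs from `Z` at `θ = 0` to `F` at `θ = π/2`. Bounding `|sin θ|` by `1` in the mean
value inequality gives the factor `π/2`. -/
theorem abs_integral_sub_integral_le_of_contDiff (hτ : IsSteinKernel μ F τ)
    {f : EuclideanSpace ℝ ι → ℝ} (hf : ContDiff ℝ 2 f) {M K : ℝ≥0} (hM : LipschitzWith M f)
    (hK : LipschitzWith K (fderiv ℝ f)) :
    |∫ ω, f (F ω) ∂μ - ∫ z, f (WithLp.toLp 2 z) ∂gaussianPi ι|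
      ≤ M * √(steinDiscrepancySq μ τ) * (Real.pi / 2) := by
  have hder := hasDerivAt_integral_interpolation hτ.integrable (hf.of_le (by norm_num)) hM
  have hmv := convex_univ.norm_image_sub_le_of_norm_hasDerivWithin_le
    (C := M * √(steinDiscrepancySq μ τ)) (x := 0) (y := Real.pi / 2)
    (fun θ _ => (hder θ).hasDerivWithinAt) (fun θ _ => by
      rw [Real.norm_eq_abs]
      refine (abs_integral_deriv_interpolation_le hτ hf hM hK _ _).trans ?_
      exact mul_le_of_le_one_left (by positivity) (Real.abs_sin_le_one θ))
    (Set.mem_univ _) (Set.mem_univ _)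
  simp only [Real.sin_pi_div_two, Real.cos_pi_div_two, Real.sin_zero, Real.cos_zero, one_smul,
    zero_smul, add_zero, zero_add, sub_zero] at hmv
  rw [integral_fun_fst (fun ω => f (F ω)), integral_fun_snd (fun z => f (WithLp.toLp 2 z))] at hmv
  simpa [abs_of_pos Real.pi_pos] using hmv

/-- A random vector with Stein kernel `τ` is close to a standard Gaussian vector in Wasserstein
distance if `τ` is close to the identity in `L²`. -/
theorem IsSteinKernel.abs_integral_sub_integral_le (hτ : IsSteinKernel μ F τ)
    {g : EuclideanSpace ℝ ι → ℝ} {M : ℝ≥0} (hg : LipschitzWith M g) :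
    |∫ ω, g (F ω) ∂μ - ∫ z, g (WithLp.toLp 2 z) ∂gaussianPi ι|
      ≤ M * √(steinDiscrepancySq μ τ) * (Real.pi / 2) := by
  refine le_of_forall_pos_le_add fun ε hε => ?_
  obtain ⟨f, hf, hfM, ⟨K, hK⟩, hfg⟩ := exists_contDiff_lipschitz_approx hg (half_pos hε)
  have h1 := abs_le.1 (abs_integral_comp_sub_le hg hfM hfg hτ.integrable)
  have h2 := abs_integral_sub_integral_le_of_contDiff hτ hf hfM hK
  have h3 := abs_le.1
    (abs_integral_comp_sub_le hg hfM hfg (integrable_toLp_gaussianPi (ι := ι)))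
  rw [abs_le] at h2 ⊢
  constructor <;> linarith [h1.1, h1.2, h2.1, h2.2, h3.1, h3.2]

end SteinKernel

/-! ### The off-diagonal tensor and its Stein kernel -/

/-- Squarefree monomials are orthonormal: a variable lying in exactly one of the two sets
contributes the factor `E[t] = 0`, a shared one `E[t²] = 1`. -/
theorem integral_prod_mul_prod_gaussianPi {κ : Type*} [Fintype κ] [DecidableEq κ]
    (S S' : Finset κ) :
    ∫ x, (∏ s ∈ S, x s) * ∏ s ∈ S', x s ∂gaussianPi κ = if S = S' then 1 else 0 := by
  have h : ∀ x : κ → ℝ, (∏ s ∈ S, x s) * ∏ s ∈ S', x s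
      = ∏ s, ((if s ∈ S then x s else 1) * if s ∈ S' then x s else 1) := fun x => by
    rw [Finset.prod_mul_distrib, prod_finset_eq_prod_univ_ite S fun t => t,
      prod_finset_eq_prod_univ_ite S' fun t => t]
  simp_rw [h]
  rw [integral_fintype_prod_eq_prod
    (fun s t => (if s ∈ S then t else 1) * if s ∈ S' then t else (1 : ℝ))]
  split_ifs with hS
  · subst hS
    refine Finset.prod_eq_one fun s _ => ?_
    split_ifs <;> simp [integral_sq_gaussianReal]
  · obtain ⟨s, hs⟩ : ∃ s, ¬(s ∈ S ↔ s ∈ S') := by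
      by_contra! hc
      exact hS (Finset.ext hc)
    refine Finset.prod_eq_zero (Finset.mem_univ s) ?_
    by_cases h1 : s ∈ S <;> by_cases h2 : s ∈ S' <;> simp_all

-- Kernels of single columns and their average

section Column

variable {n d : ℕ}

/-- The positions of the rows `A` in the column `i` of an `n × d` matrix. -/
def columnPositions (A : Finset (Fin n)) (i : Fin d) : Finset (Fin n × Fin d) :=
  A ×ˢ {i}

theorem prod_columnPositions (A : Finset (Fin n)) (i : Fin d) (f : Fin n × Fin d → ℝ) :
    ∏ s ∈ columnPositions A i, f s = ∏ k ∈ A, f (k, i) := by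
  simp [columnPositions]

theorem integrable_prod_column (A : Finset (Fin n)) (i : Fin d) (m : ℕ) :
    Integrable (fun x : Fin n × Fin d → ℝ => ∏ k ∈ A, x (k, i) ^ m) (gaussianPi _) := by
  simpa only [prod_columnPositions A i fun s => _] using
    integrable_prod_finset (columnPositions A i) (integrable_pow_gaussianReal m)

theorem integrable_prod_column_one (A : Finset (Fin n)) (i : Fin d) :
    Integrable (fun x : Fin n × Fin d → ℝ => ∏ k ∈ A, x (k, i)) (gaussianPi _) := by
  simpa using integrable_prod_column A i 1

theorem integral_prod_column (A : Finset (Fin n)) (i : Fin d) (m : ℕ) :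
    ∫ x : Fin n × Fin d → ℝ, ∏ k ∈ A, x (k, i) ^ m ∂gaussianPi _
      = (∫ t, t ^ m ∂gaussianReal 0 1) ^ A.card := by
  have := integral_prod_finset (columnPositions A i) (fun t => t ^ m)
  rw [columnPositions, Finset.card_product, Finset.card_singleton, mul_one] at this
  rw [← this]
  congr 1
  ext x
  rw [← prod_columnPositions A i fun s => x s ^ m, columnPositions]

/-- The derivative of `∏_{k ∈ B} c_k` in the variable `c_r`. -/
def prodDeriv (B : Finset (Fin n)) (r : Fin n) (c : Fin n → ℝ) : ℝ :=
  if r ∈ B then ∏ k ∈ B.erase r, c k else 0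

theorem measurable_prodDeriv (B : Finset (Fin n)) (r : Fin n) : Measurable (prodDeriv B r) := by
  unfold prodDeriv
  split_ifs <;> fun_prop

theorem hasDerivAt_prod_update (B : Finset (Fin n)) (r : Fin n) (i j : Fin d)
    (x : Fin n × Fin d → ℝ) (t₀ : ℝ) :
    HasDerivAt (fun t => ∏ k ∈ B, Function.update x (r, i) t (k, j))
      (if j = i then prodDeriv B r (fun k => x (k, i)) else 0) t₀ := by
  have hne : ∀ k t, k ≠ r ∨ j ≠ i → Function.update x (r, i) t (k, j) = x (k, j) := fun k t h =>
    Function.update_of_ne (by rcases h with h | h <;> simp [h]) _ _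
  by_cases hj : j = i
  · subst hj
    by_cases hr : r ∈ B
    · have : (fun t => ∏ k ∈ B, Function.update x (r, j) t (k, j))
          = fun t => t * ∏ k ∈ B.erase r, x (k, j) := by
        ext t
        rw [← Finset.mul_prod_erase _ _ hr, Function.update_self]
        congr 1
        exact Finset.prod_congr rfl fun k hk => hne k t (Or.inl (Finset.ne_of_mem_erase hk))
      rw [this]
      simpa [prodDeriv, hr] using (hasDerivAt_id t₀).mul_const (∏ k ∈ B.erase r, x (k, j))
    · have : (fun t => ∏ k ∈ B, Function.update x (r, j) t (k, j))
          = fun t => ∏ k ∈ B, x (k, j) := by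
        ext t
        exact Finset.prod_congr rfl fun k hk => hne k t (Or.inl fun h => hr (h ▸ hk))
      rw [this]
      simpa [prodDeriv, hr] using hasDerivAt_const t₀ _
  · have : (fun t => ∏ k ∈ B, Function.update x (r, i) t (k, j))
        = fun t => ∏ k ∈ B, x (k, j) := by
      ext t
      exact Finset.prod_congr rfl fun k hk => hne k t (Or.inr hj)
    rw [this]
    simpa [hj] using hasDerivAt_const t₀ _

/-- The contribution of a single column to the Stein kernel. -/
def columnKernel (A B : Finset (Fin n)) (r : Fin n) (c : Fin n → ℝ) : ℝ :=
  (∏ k ∈ A.erase r, c k) * prodDeriv B r c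

theorem measurable_columnKernel (A B : Finset (Fin n)) (r : Fin n) :
    Measurable (columnKernel A B r) :=
  Measurable.mul (by fun_prop) (measurable_prodDeriv B r)

/-- The fourth moment of the standard Gaussian. -/
noncomputable def gaussianFourthMoment : ℝ := ∫ t, t ^ 4 ∂gaussianReal 0 1

theorem gaussianFourthMoment_nonneg : 0 ≤ gaussianFourthMoment :=
  integral_nonneg fun t => by positivity

variable {p : ℕ} {A B : Finset (Fin n)} {r : Fin n}

/-- If `r ∈ B`, orthonormality of the monomials applies, and `A \ r = B \ r` forces `A = B`.
Otherwise the kernel vanishes and `A ≠ B`. -/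
theorem integral_columnKernel (hr : r ∈ A) (i : Fin d) :
    ∫ x : Fin n × Fin d → ℝ, columnKernel A B r (fun k => x (k, i)) ∂gaussianPi _
      = if A = B then 1 else 0 := by
  by_cases hrB : r ∈ B
  · have h := integral_prod_mul_prod_gaussianPi (columnPositions (A.erase r) i)
      (columnPositions (B.erase r) i)
    simp only [prod_columnPositions] at h
    simp only [columnKernel, prodDeriv, hrB, if_true]
    rw [h]
    refine if_congr ?_ rfl rfl
    constructor
    · intro h
      have h : A.erase r = B.erase r := by
        ext k
        simpa [columnPositions] using congrArg ((k, i) ∈ ·) h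
      rw [← Finset.insert_erase hr, h, Finset.insert_erase hrB]
    · rintro rfl; rfl
  · have hAB : A ≠ B := fun h => hrB (h ▸ hr)
    simp [columnKernel, prodDeriv, hrB, hAB]

/-- From `(uv)² ≤ (u⁴ + v⁴)/2`, where `u` and `v` are products of `p - 1` independent Gaussians. -/
theorem memLp_columnKernel_and_integral_sq_le (hA : A.card = p) (hB : B.card = p) (hr : r ∈ A)
    (i : Fin d) :
    MemLp (fun x : Fin n × Fin d → ℝ => columnKernel A B r (fun k => x (k, i))) 2
      (gaussianPi _) ∧
    ∫ x : Fin n × Fin d → ℝ, columnKernel A B r (fun k => x (k, i)) ^ 2 ∂gaussianPi _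
      ≤ gaussianFourthMoment ^ (p - 1) := by
  by_cases hrB : r ∈ B
  · have hi := ((integrable_prod_column (A.erase r) i 4).add
      (integrable_prod_column (B.erase r) i 4)).div_const 2
    have hle : ∀ x : Fin n × Fin d → ℝ, columnKernel A B r (fun k => x (k, i)) ^ 2
        ≤ (∏ k ∈ A.erase r, x (k, i) ^ 4 + ∏ k ∈ B.erase r, x (k, i) ^ 4) / 2 := fun x => by
      simp only [columnKernel, prodDeriv, hrB, if_true, Finset.prod_pow]
      nlinarith [sq_nonneg ((∏ k ∈ A.erase r, x (k, i)) ^ 2 - (∏ k ∈ B.erase r, x (k, i)) ^ 2)]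
    have hm : AEStronglyMeasurable (fun x : Fin n × Fin d → ℝ =>
        columnKernel A B r (fun k => x (k, i))) (gaussianPi _) :=
      ((measurable_columnKernel A B r).comp
        (measurable_pi_lambda _ fun k => measurable_pi_apply (k, i))).aestronglyMeasurable
    have hL : MemLp (fun x : Fin n × Fin d → ℝ => columnKernel A B r (fun k => x (k, i))) 2
        (gaussianPi _) := by
      refine (memLp_two_iff_integrable_sq hm).2 (hi.mono' (hm.pow 2) (ae_of_all _ fun x => ?_))
      rw [Real.norm_of_nonneg (sq_nonneg _)]
      exact hle x
    refine ⟨hL, (integral_mono hL.integrable_sq hi hle).trans (le_of_eq ?_)⟩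
    simp only [Pi.add_apply]
    rw [integral_div, integral_add (integrable_prod_column _ i 4) (integrable_prod_column _ i 4),
      integral_prod_column, integral_prod_column, Finset.card_erase_of_mem hr,
      Finset.card_erase_of_mem hrB, hA, hB, gaussianFourthMoment]
    ring
  · have : ∀ x : Fin n × Fin d → ℝ, columnKernel A B r (fun k => x (k, i)) = 0 := fun x => by
      simp [columnKernel, prodDeriv, hrB]
    simp only [this]
    refine ⟨MemLp.zero', ?_⟩
    simpa using pow_nonneg gaussianFourthMoment_nonneg (p - 1)

theorem indepFun_columns {φ ψ : (Fin n → ℝ) → ℝ} (hφ : Measurable φ) (hψ : Measurable ψ)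
    {i j : Fin d} (hij : i ≠ j) :
    IndepFun (fun x : Fin n × Fin d → ℝ => φ fun k => x (k, i))
      (fun x => ψ fun k => x (k, j)) (gaussianPi _) := by
  have hind : iIndepFun (fun (s : Fin n × Fin d) (x : Fin n × Fin d → ℝ) => x s)
      (gaussianPi (Fin n × Fin d)) :=
    iIndepFun_pi (X := fun _ => id) fun _ => aemeasurable_id
  have hmem : ∀ (l : Fin d) (k : Fin n), (k, l) ∈ columnPositions (Finset.univ : Finset (Fin n)) l :=
    fun l k => by simp [columnPositions]
  have hdisj : Disjoint (columnPositions (Finset.univ : Finset (Fin n)) i)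
      (columnPositions Finset.univ j) := by
    rw [Finset.disjoint_left]
    rintro ⟨k, l⟩ h1 h2
    simp only [columnPositions, Finset.mem_product, Finset.mem_univ, true_and,
      Finset.mem_singleton] at h1 h2
    subst h1 h2
    exact hij rfl
  exact (hind.indepFun_finset _ _ hdisj fun s => measurable_pi_apply s).comp
    (φ := fun y => φ fun k => y ⟨(k, i), hmem i k⟩) (ψ := fun y => ψ fun k => y ⟨(k, j), hmem j k⟩)
    (hφ.comp (measurable_pi_lambda _ fun k => measurable_pi_apply _))
    (hψ.comp (measurable_pi_lambda _ fun k => measurable_pi_apply _))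

/-- The average of the column kernels. -/
noncomputable def averageKernel (A B : Finset (Fin n)) (r : Fin n) (x : Fin n × Fin d → ℝ) : ℝ :=
  (d : ℝ)⁻¹ * ∑ i : Fin d, columnKernel A B r fun k => x (k, i)

theorem memLp_averageKernel (hA : A.card = p) (hB : B.card = p) (hr : r ∈ A) :
    MemLp (averageKernel (d := d) A B r) 2 (gaussianPi _) :=
  (memLp_finsetSum _ fun i _ =>
    (memLp_columnKernel_and_integral_sq_le hA hB hr i).1).const_mul _

/-- The subtracted constant is the mean, so the integral is the variance of an average of `d`
independent terms. The exact zero for `r ∉ B` is what saves a factor `n` in the final count. -/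
theorem integral_averageKernel_sub_sq_le (hd : 0 < d) (hA : A.card = p) (hB : B.card = p)
    (hr : r ∈ A) :
    ∫ x : Fin n × Fin d → ℝ, (averageKernel A B r x - if A = B then 1 else 0) ^ 2 ∂gaussianPi _
      ≤ if r ∈ B then gaussianFourthMoment ^ (p - 1) / d else 0 := by
  have hd' : (0 : ℝ) < d := by exact_mod_cast hd
  by_cases hrB : r ∈ B
  swap
  · have hAB : A ≠ B := fun h => hrB (h ▸ hr)
    simp [averageKernel, columnKernel, prodDeriv, hrB, hAB]
  have hL := fun i : Fin d => (memLp_columnKernel_and_integral_sq_le hA hB hr i).1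
  have hmean : ∫ x : Fin n × Fin d → ℝ, averageKernel A B r x ∂gaussianPi _
      = if A = B then 1 else 0 := by
    unfold averageKernel
    rw [integral_const_mul, integral_finsetSum _ fun i _ => (hL i).integrable (by norm_num)]
    simp_rw [integral_columnKernel hr]
    simp [hd'.ne']
  have hvar := variance_eq_integral (X := averageKernel (d := d) A B r) (μ := gaussianPi _)
    (memLp_averageKernel hA hB hr).aestronglyMeasurable.aemeasurable
  rw [hmean] at hvar
  rw [← hvar, if_pos hrB]
  have hsum : averageKernel (d := d) A B r = fun x => (d : ℝ)⁻¹ *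
      (∑ i : Fin d, fun x : Fin n × Fin d → ℝ => columnKernel A B r fun k => x (k, i)) x := by
    ext x
    simp [averageKernel]
  rw [hsum, variance_const_mul, IndepFun.variance_sum (fun i _ => hL i) fun i _ j _ hij =>
    indepFun_columns (measurable_columnKernel A B r) (measurable_columnKernel A B r) hij]
  calc _ ≤ (d : ℝ)⁻¹ ^ 2 * ∑ i : Fin d, gaussianFourthMoment ^ (p - 1) := by
        gcongr with i
        exact (variance_le_expectation_sq (hL i).1).trans
          (memLp_columnKernel_and_integral_sq_le hA hB hr i).2
    _ = _ := by
        simp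
        field_simp

end Column

-- The tensor indexed by subsets: Stein kernel and discrepancy

section SetTensor

/-- The `p`-element subsets of `{1, …, n}`. -/
abbrev KSubset (p n : ℕ) : Type := {A : Finset (Fin n) // A.card = p}

variable {p n d : ℕ}

/-- The tensor `d^{-1/2} ∑ᵢ ∏_{k ∈ A} x_{ki}` indexed by `p`-element subsets `A`. -/
noncomputable def setTensor (p : ℕ) {n d : ℕ} (x : Fin n × Fin d → ℝ) :
    EuclideanSpace ℝ (KSubset p n) :=
  WithLp.toLp 2 fun A => (√d)⁻¹ * ∑ i : Fin d, ∏ k ∈ A.1, x (k, i)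

theorem integrable_setTensor :
    Integrable (setTensor p (n := n) (d := d)) (gaussianPi _) :=
  integrable_toLp fun A =>
    (integrable_finsetSum _ fun i _ => integrable_prod_column_one A.1 i).const_mul _

theorem hasDerivAt_setTensor_update (r : Fin n) (i : Fin d) (x : Fin n × Fin d → ℝ) (t₀ : ℝ) :
    HasDerivAt (fun t => setTensor p (Function.update x (r, i) t))
      (WithLp.toLp 2 fun B : KSubset p n => (√d)⁻¹ * prodDeriv B.1 r fun k => x (k, i)) t₀ := by
  have h : HasDerivAt (fun t (B : KSubset p n) =>
      (√d)⁻¹ * ∑ j : Fin d, ∏ k ∈ B.1, Function.update x (r, i) t (k, j))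
      (fun B : KSubset p n => (√d)⁻¹ * prodDeriv B.1 r fun k => x (k, i)) t₀ := by
    refine hasDerivAt_pi.2 fun B => HasDerivAt.const_mul _ ?_
    have := HasDerivAt.fun_sum (u := Finset.univ) fun j _ =>
      hasDerivAt_prod_update B.1 r i j x t₀
    simpa using this
  exact (PiLp.continuousLinearEquiv 2 ℝ
    (fun _ : KSubset p n => ℝ)).symm.hasFDerivAt.comp_hasDerivAt t₀ h

/-- Integration by parts in `x_{ri}`: once this variable is split off, the remaining product over `A
\ r` does not depend on it, and the derivative falls on `h` alone. -/
theorem integral_prod_column_mul_comp {h : EuclideanSpace ℝ (KSubset p n) → ℝ}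
    (hh : ContDiff ℝ 1 h) {K K' : ℝ} (hK : ∀ y, |h y| ≤ K) (hK' : ∀ y, ‖fderiv ℝ h y‖ ≤ K')
    (A : KSubset p n) {r : Fin n} (hr : r ∈ A.1) (i : Fin d) :
    ∫ x : Fin n × Fin d → ℝ, (∏ k ∈ A.1, x (k, i)) * h (setTensor p x) ∂gaussianPi _
      = ∑ B : KSubset p n, (√d)⁻¹ * ∫ x : Fin n × Fin d → ℝ,
        columnKernel A.1 B.1 r (fun k => x (k, i))
          * fderiv ℝ h (setTensor p x) (EuclideanSpace.single B 1) ∂gaussianPi _ := by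
  have hFm := (integrable_setTensor (p := p) (n := n) (d := d)).1
  have hd1 : Continuous fun y => fderiv ℝ h y := hh.continuous_fderiv one_ne_zero
  have hhF : AEStronglyMeasurable (fun x : Fin n × Fin d → ℝ => h (setTensor p x))
    (gaussianPi _) := hh.continuous.comp_aestronglyMeasurable hFm
  have hi : ∀ B : KSubset p n, Integrable (fun x : Fin n × Fin d → ℝ =>
      columnKernel A.1 B.1 r (fun k => x (k, i))
        * fderiv ℝ h (setTensor p x) (EuclideanSpace.single B 1)) (gaussianPi _) := fun B =>
    ((memLp_columnKernel_and_integral_sq_le A.2 B.2 hr i).1.integrable (by norm_num)).mul_bdd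
      (c := K') ((hd1.clm_apply continuous_const).comp_aestronglyMeasurable hFm)
      (ae_of_all _ fun x => (ContinuousLinearMap.le_opNorm _ _).trans (by simpa using hK' _))
  have hsplit : ∀ x : Fin n × Fin d → ℝ, (∏ k ∈ A.1, x (k, i)) * h (setTensor p x)
      = x (r, i) * ((∏ k ∈ A.1.erase r, x (k, i)) * h (setTensor p x)) := fun x => by
    rw [← Finset.mul_prod_erase _ _ hr, mul_assoc]
  simp_rw [← integral_const_mul]
  rw [← integral_finsetSum _ fun B _ => (hi B).const_mul _]
  simp_rw [hsplit]
  refine integral_eval_mul_gaussianPi (r, i) (fun x => ?_) ?_ ?_ ?_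
  · have hW : ∀ t, ∏ k ∈ A.1.erase r, Function.update x (r, i) t (k, i)
        = ∏ k ∈ A.1.erase r, x (k, i) := fun t =>
      Finset.prod_congr rfl fun k hk =>
        Function.update_of_ne (by simp [Finset.ne_of_mem_erase hk]) _ _
    simp_rw [hW]
    have h1 := ((hh.differentiable one_ne_zero _).hasFDerivAt.comp_hasDerivAt _
      (hasDerivAt_setTensor_update (p := p) r i x (x (r, i)))).const_mul
      (∏ k ∈ A.1.erase r, x (k, i))
    rw [Function.update_eq_self, ContinuousLinearMap.apply_eq_sum_single, Finset.mul_sum] at h1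
    convert! h1 using 1
    refine Finset.sum_congr rfl fun B _ => ?_
    simp only [columnKernel]
    ring
  · exact (integrable_prod_column_one _ i).mul_bdd (c := K) hhF (ae_of_all _ fun x => hK _)
  · simp_rw [← hsplit]
    exact (integrable_prod_column_one _ i).mul_bdd (c := K) hhF (ae_of_all _ fun x => hK _)
  · exact integrable_finsetSum _ fun B _ => (hi B).const_mul _

theorem isSteinKernel_setTensor (r : KSubset p n → Fin n) (hr : ∀ A, r A ∈ A.1) :
    IsSteinKernel (gaussianPi (Fin n × Fin d)) (setTensor p)
      fun A B => averageKernel A.1 B.1 (r A) where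
  integrable := integrable_setTensor
  memLp A B := memLp_averageKernel A.2 B.2 (hr A)
  integral_mul := by
    rintro h hh ⟨K, hK⟩ ⟨K', hK'⟩ A
    have hFm := (integrable_setTensor (p := p) (n := n) (d := d)).1
    have hd1 : Continuous fun y => fderiv ℝ h y := hh.continuous_fderiv one_ne_zero
    have hi1 : ∀ i : Fin d, Integrable (fun x : Fin n × Fin d → ℝ =>
        (∏ k ∈ A.1, x (k, i)) * h (setTensor p x)) (gaussianPi _) := fun i =>
      (integrable_prod_column_one _ i).mul_bdd (c := K)
        (hh.continuous.comp_aestronglyMeasurable hFm) (ae_of_all _ fun x => hK _)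
    have hi2 : ∀ (B : KSubset p n) (i : Fin d), Integrable (fun x : Fin n × Fin d → ℝ =>
        columnKernel A.1 B.1 (r A) (fun k => x (k, i))
          * fderiv ℝ h (setTensor p x) (EuclideanSpace.single B 1)) (gaussianPi _) := fun B i =>
      ((memLp_columnKernel_and_integral_sq_le A.2 B.2 (hr A) i).1.integrable
        (by norm_num)).mul_bdd
        (c := K') ((hd1.clm_apply continuous_const).comp_aestronglyMeasurable hFm)
        (ae_of_all _ fun x => (ContinuousLinearMap.le_opNorm _ _).trans (by simpa using hK' _))
    have e1 : ∀ x : Fin n × Fin d → ℝ, setTensor p x A * h (setTensor p x)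
        = (√d)⁻¹ * ∑ i, (∏ k ∈ A.1, x (k, i)) * h (setTensor p x) := fun x => by
      rw [← Finset.sum_mul, ← mul_assoc]
      rfl
    have e2 : ∀ (B : KSubset p n) (x : Fin n × Fin d → ℝ), averageKernel A.1 B.1 (r A) x
          * fderiv ℝ h (setTensor p x) (EuclideanSpace.single B 1)
        = (d : ℝ)⁻¹ * ∑ i, columnKernel A.1 B.1 (r A) (fun k => x (k, i))
          * fderiv ℝ h (setTensor p x) (EuclideanSpace.single B 1) := fun B x => by
      rw [← Finset.sum_mul, ← mul_assoc]
      rfl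
    simp_rw [e1, e2, integral_const_mul]
    rw [integral_finsetSum _ fun i _ => hi1 i]
    simp_rw [fun B => integral_finsetSum Finset.univ fun i _ => hi2 B i,
      fun i => integral_prod_column_mul_comp hh hK hK' A (hr A) i]
    rw [Finset.sum_comm, Finset.mul_sum]
    refine Finset.sum_congr rfl fun B _ => ?_
    -- One `(√d)⁻¹` comes from the normalisation of `F_A`, the other from the chain rule.
    rw [← Finset.mul_sum, ← mul_assoc, ← mul_inv, Real.mul_self_sqrt (Nat.cast_nonneg d)]

theorem card_kSubset_le (p n : ℕ) : Fintype.card (KSubset p n) ≤ n ^ p := by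
  rw [Fintype.card_finset_len, Fintype.card_fin]
  exact Nat.choose_le_pow n p

theorem card_filter_mem_kSubset_le (p n : ℕ) (r : Fin n) :
    (Finset.univ.filter fun B : KSubset p n => r ∈ B.1).card ≤ n ^ (p - 1) := by
  calc _ ≤ ((Finset.univ : Finset (Fin n)).powersetCard (p - 1)).card := by
        refine Finset.card_le_card_of_injOn (fun B => B.1.erase r) (fun B hB => ?_) ?_
        · simp only [Finset.coe_filter, Finset.mem_univ, true_and, Set.mem_ofPred_eq] at hB
          simp [Finset.mem_powersetCard, Finset.card_erase_of_mem hB, B.2]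
        · intro B hB B' hB' h
          simp only [Finset.coe_filter, Finset.mem_univ, true_and, Set.mem_ofPred_eq] at hB hB'
          refine Subtype.ext ?_
          rw [← Finset.insert_erase hB, ← Finset.insert_erase hB']
          exact congrArg (insert r) h
    _ ≤ n ^ (p - 1) := by
        rw [Finset.card_powersetCard, Finset.card_univ, Fintype.card_fin]
        exact Nat.choose_le_pow n (p - 1)

/-- There are at most `n^p` choices of `A`, then at most `n^(p-1)` sets `B` containing `r A`; each
such pair costs at most `gaussianFourthMoment ^ (p - 1) / d`. -/
theorem steinDiscrepancySq_setTensor_le (hp : 1 ≤ p) (hd : 0 < d) (r : KSubset p n → Fin n)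
    (hr : ∀ A, r A ∈ A.1) :
    steinDiscrepancySq (gaussianPi (Fin n × Fin d))
        (fun A B : KSubset p n => averageKernel A.1 B.1 (r A))
      ≤ gaussianFourthMoment ^ (p - 1) * ((n : ℝ) ^ (2 * p - 1) / d) := by
  have hm : 0 ≤ gaussianFourthMoment ^ (p - 1) / d :=
    div_nonneg (pow_nonneg gaussianFourthMoment_nonneg _) (Nat.cast_nonneg d)
  calc _ ≤ ∑ A : KSubset p n, ∑ B : KSubset p n,
        if r A ∈ B.1 then gaussianFourthMoment ^ (p - 1) / d else 0 := by
        refine Finset.sum_le_sum fun A _ => Finset.sum_le_sum fun B _ => ?_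
        simpa [Subtype.ext_iff] using integral_averageKernel_sub_sq_le hd A.2 B.2 (hr A)
    _ ≤ ∑ A : KSubset p n, (n : ℝ) ^ (p - 1) * (gaussianFourthMoment ^ (p - 1) / d) := by
        refine Finset.sum_le_sum fun A _ => ?_
        rw [← Finset.sum_filter, Finset.sum_const, nsmul_eq_mul]
        refine mul_le_mul_of_nonneg_right ?_ hm
        exact_mod_cast card_filter_mem_kSubset_le p n (r A)
    _ ≤ (n : ℝ) ^ p * ((n : ℝ) ^ (p - 1) * (gaussianFourthMoment ^ (p - 1) / d)) := by
        rw [Finset.sum_const, nsmul_eq_mul, Finset.card_univ]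
        refine mul_le_mul_of_nonneg_right ?_ (by positivity)
        exact_mod_cast card_kSubset_le p n
    _ = _ := by
        rw [show 2 * p - 1 = p + (p - 1) by omega, pow_add]
        ring

theorem abs_integral_setTensor_sub_le (hp : 1 ≤ p) (hd : 0 < d)
    {g : EuclideanSpace ℝ (KSubset p n) → ℝ} {M : ℝ≥0} (hg : LipschitzWith M g) :
    |∫ x : Fin n × Fin d → ℝ, g (setTensor p x) ∂gaussianPi _
        - ∫ z, g (WithLp.toLp 2 z) ∂gaussianPi _|
      ≤ M * √(gaussianFourthMoment ^ (p - 1)) * (Real.pi / 2) * √((n : ℝ) ^ (2 * p - 1) / d) := by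
  have hne : ∀ A : KSubset p n, A.1.Nonempty := fun A =>
    Finset.card_pos.1 (by rw [A.2]; exact hp)
  choose r hr using hne
  refine ((isSteinKernel_setTensor r hr).abs_integral_sub_integral_le hg).trans ?_
  have := Real.sqrt_le_sqrt (steinDiscrepancySq_setTensor_le hp hd r hr)
  rw [Real.sqrt_mul (pow_nonneg gaussianFourthMoment_nonneg _)] at this
  calc _ ≤ M * (√(gaussianFourthMoment ^ (p - 1)) * √((n : ℝ) ^ (2 * p - 1) / d))
        * (Real.pi / 2) := by gcongr
    _ = _ := by ring

end SetTensor

-- From subsets back to symmetric off-diagonal tensors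

section Spread

variable {p n d : ℕ}

/-- The set of entries of an off-diagonal index. -/
def OffDiag.toKSubset (j : OffDiag p n) : KSubset p n :=
  ⟨Finset.univ.map j, by simp⟩

/-- The increasing enumeration of a `p`-element subset. -/
def KSubset.toOffDiag (A : KSubset p n) : OffDiag p n := (A.1.orderEmbOfFin A.2).toEmbedding

/-- The symmetric off-diagonal tensor with prescribed entries on the `p`-element subsets. -/
noncomputable def symmTensor (y : EuclideanSpace ℝ (KSubset p n)) :
    EuclideanSpace ℝ (OffDiag p n) :=
  WithLp.toLp 2 fun j => y j.toKSubset

theorem card_filter_toKSubset_le (A : KSubset p n) :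
    (Finset.univ.filter fun j : OffDiag p n => j.toKSubset = A).card ≤ p ^ p := by
  calc _ ≤ (Fintype.piFinset fun _ : Fin p => A.1).card := by
        refine Finset.card_le_card_of_injOn (fun j => (j : Fin p → Fin n)) (fun j hj => ?_)
          fun _ _ _ _ h => DFunLike.coe_injective h
        simp only [Finset.coe_filter, Finset.mem_univ, true_and, Set.mem_ofPred_eq] at hj
        simp only [Finset.mem_coe, Fintype.mem_piFinset]
        intro k
        rw [← hj]
        simp [OffDiag.toKSubset]
    _ = p ^ p := by simp [Fintype.card_piFinset, A.2]

/-- Each entry is repeated at most `p ^ p` times, a crude substitute for `p!` that is enough for a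
constant depending on `p` only. -/
theorem lipschitzWith_symmTensor :
    LipschitzWith (NNReal.sqrt (p ^ p)) (symmTensor (p := p) (n := n)) := by
  refine LipschitzWith.of_dist_le_mul fun y y' => ?_
  rw [EuclideanSpace.dist_eq, EuclideanSpace.dist_eq, Real.coe_sqrt,
    ← Real.sqrt_mul (NNReal.coe_nonneg _)]
  refine Real.sqrt_le_sqrt ?_
  calc ∑ j : OffDiag p n, dist (y j.toKSubset) (y' j.toKSubset) ^ 2
      = ∑ A : KSubset p n, ∑ j : OffDiag p n with j.toKSubset = A, dist (y A) (y' A) ^ 2 := by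
        rw [← Finset.sum_fiberwise Finset.univ OffDiag.toKSubset]
        refine Finset.sum_congr rfl fun A _ => Finset.sum_congr rfl fun j hj => ?_
        rw [(Finset.mem_filter.1 hj).2]
    _ ≤ _ := by
        rw [Finset.mul_sum]
        refine Finset.sum_le_sum fun A _ => ?_
        rw [Finset.sum_const, nsmul_eq_mul]
        refine mul_le_mul_of_nonneg_right ?_ (by positivity)
        exact_mod_cast card_filter_toKSubset_le A

theorem offDiagTensor_eq_symmTensor (x : Fin n × Fin d → ℝ) :
    offDiagTensor p (fun r i => x (r, i)) = symmTensor (setTensor p x) := by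
  ext j
  simp [offDiagTensor, symmTensor, setTensor, OffDiag.toKSubset, Finset.prod_map]

theorem exists_perm_trans_eq_toOffDiag (j : OffDiag p n) :
    ∃ σ : Equiv.Perm (Fin p), σ.toEmbedding.trans j = j.toKSubset.toOffDiag := by
  have h : ∀ k, ∃ l, j l = j.toKSubset.toOffDiag k := fun k => by
    have := Finset.mem_map.1 (j.toKSubset.1.orderEmbOfFin_mem j.toKSubset.2 k)
    obtain ⟨l, _, hl⟩ := this
    exact ⟨l, hl⟩
  choose f hf using h
  have hinj : Function.Injective f := fun a b hab =>
    j.toKSubset.toOffDiag.injective (by rw [← hf, ← hf, hab])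
  refine ⟨Equiv.ofBijective f (Finite.injective_iff_bijective.1 hinj), ?_⟩
  ext k
  simp [hf]

theorem KSubset.toOffDiag_injective :
    Function.Injective (KSubset.toOffDiag : KSubset p n → OffDiag p n) := fun A B h => by
  refine Subtype.ext (Finset.coe_injective ?_)
  rw [← A.1.range_orderEmbOfFin A.2, ← B.1.range_orderEmbOfFin B.2]
  exact congrArg (fun j : OffDiag p n => Set.range j) h

section

variable {Ω : Type*} [MeasurableSpace Ω] {P : Measure Ω}

theorem IsStdGaussianMatrix.integral_comp_offDiagTensor {X : Fin n → Fin d → Ω → ℝ}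
    (hX : IsStdGaussianMatrix P X) {g : EuclideanSpace ℝ (OffDiag p n) → ℝ} (hg : Continuous g) :
    ∫ ω, g (offDiagTensor p fun r i => X r i ω) ∂P
      = ∫ x : Fin n × Fin d → ℝ, g (symmTensor (setTensor p x)) ∂gaussianPi _ := by
  have hlaw := hX.indep.hasLaw_pi fun a : Fin n × Fin d => hX.hasLaw a.1 a.2
  have hm : AEStronglyMeasurable (fun x : Fin n × Fin d → ℝ => g (symmTensor (setTensor p x)))
      (gaussianPi _) :=
    (hg.comp lipschitzWith_symmTensor.continuous).comp_aestronglyMeasurable integrable_setTensor.1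
  rw [← hlaw.integral_comp hm]
  refine integral_congr_ae (ae_of_all _ fun ω => ?_)
  simp only [Function.comp_apply]
  rw [← offDiagTensor_eq_symmTensor]

/-- The increasing coordinates form an i.i.d. family indexed by subsets. Symmetry determines the
others almost surely, simultaneously because there are finitely many indices. -/
theorem IsStdGaussianSymmTensor.integral_comp {Z : Ω → EuclideanSpace ℝ (OffDiag p n)}
    (hZ : IsStdGaussianSymmTensor P Z) {g : EuclideanSpace ℝ (OffDiag p n) → ℝ}
    (hg : Continuous g) :
    ∫ ω, g (Z ω) ∂P
      = ∫ z : KSubset p n → ℝ, g (symmTensor (WithLp.toLp 2 z)) ∂gaussianPi _ := by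
  have hind : iIndepFun (fun (A : KSubset p n) ω => Z ω A.toOffDiag) P :=
    hZ.indep.precomp (g := fun A : KSubset p n =>
      ⟨A.toOffDiag, (A.1.orderEmbOfFin A.2).strictMono⟩)
      fun A B h => KSubset.toOffDiag_injective (congrArg Subtype.val h)
  have hlaw := hind.hasLaw_pi fun A : KSubset p n => hZ.hasLaw A.toOffDiag
  have hm : AEStronglyMeasurable (fun z : KSubset p n → ℝ => g (symmTensor (WithLp.toLp 2 z)))
      (gaussianPi _) :=
    (hg.comp lipschitzWith_symmTensor.continuous).comp_aestronglyMeasurable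
      integrable_toLp_gaussianPi.1
  rw [← hlaw.integral_comp hm]
  have hae : ∀ᵐ ω ∂P, ∀ j : OffDiag p n, Z ω j.toKSubset.toOffDiag = Z ω j := by
    refine ae_all_iff.2 fun j => ?_
    obtain ⟨σ, hσ⟩ := exists_perm_trans_eq_toOffDiag j
    rw [← hσ]
    exact hZ.symm σ j
  refine integral_congr_ae ?_
  filter_upwards [hae] with ω hω
  simp only [Function.comp_apply]
  congr 1
  ext j
  simp [symmTensor, hω]

end

/-- The constant in the bound for the Wasserstein distance. -/
noncomputable def tensorConstant (p : ℕ) : ℝ :=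
  √((p : ℝ) ^ p) * √(gaussianFourthMoment ^ (p - 1)) * (Real.pi / 2)

theorem wassersteinDist_offDiagTensor_le (hp : 1 ≤ p) (hd : 0 < d) {Ω Ω' : Type*}
    [MeasurableSpace Ω] [MeasurableSpace Ω'] {P : Measure Ω} {P' : Measure Ω'}
    {X : Fin n → Fin d → Ω → ℝ} {Z : Ω' → EuclideanSpace ℝ (OffDiag p n)}
    (hX : IsStdGaussianMatrix P X) (hZ : IsStdGaussianSymmTensor P' Z) :
    wassersteinDist P (fun ω => offDiagTensor p (fun r i => X r i ω)) P' Z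
      ≤ ENNReal.ofReal (tensorConstant p * √((n : ℝ) ^ (2 * p - 1) / d)) := by
  refine iSup₂_le fun g hg => ENNReal.ofReal_le_ofReal ?_
  rw [hX.integral_comp_offDiagTensor hg.continuous, hZ.integral_comp hg.continuous]
  -- Composing `g` with `symmTensor` multiplies its Lipschitz constant by `√(p ^ p)`, the first
  -- factor of `tensorConstant`.
  refine (le_abs_self _).trans ((abs_integral_setTensor_sub_le hp hd
    (hg.comp lipschitzWith_symmTensor)).trans (le_of_eq ?_))
  simp [tensorConstant, Real.coe_sqrt]

/-- `E[t⁴] ≥ (E[t²])² = 1`; only positivity is needed, so that the constant is positive. -/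
theorem gaussianFourthMoment_pos : 0 < gaussianFourthMoment := by
  have h : Integrable (fun t : ℝ => t ^ 2) (gaussianReal 0 1) := integrable_pow_gaussianReal 2
  have h4 := integrable_pow_gaussianReal 4
  have hm : MemLp (fun t : ℝ => t ^ 2) 2 (gaussianReal 0 1) :=
    (memLp_two_iff_integrable_sq h.1).2 (by simpa [← pow_mul] using h4)
  have h1 := sq_integral_le_integral_sq hm
  have h2 : ∫ t : ℝ, t ^ 2 ∂gaussianReal 0 1 = 1 := by
    simpa [pow_two] using integral_sq_gaussianReal
  rw [h2] at h1
  simp only [← pow_mul] at h1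
  norm_num at h1
  exact lt_of_lt_of_le one_pos h1

theorem tensorConstant_pos (hp : 1 ≤ p) : 0 < tensorConstant p := by
  have := gaussianFourthMoment_pos
  have hp' : (0 : ℝ) < p := by exact_mod_cast hp
  unfold tensorConstant
  positivity

end Spread

-- The main theorem

theorem mainTheorem5 (p : ℕ) (hp : 2 ≤ p) :
    (∃ C : ℝ, 0 < C ∧ ∀ (n d : ℕ), 0 < d →
      ∀ (Ω : Type*) (Ω' : Type*) [MeasurableSpace Ω] [MeasurableSpace Ω']
        (P : Measure Ω) (P' : Measure Ω') [IsProbabilityMeasure P] [IsProbabilityMeasure P']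
        (X : Fin n → Fin d → Ω → ℝ) (Z : Ω' → EuclideanSpace ℝ (OffDiag p n)),
        IsStdGaussianMatrix P X → IsStdGaussianSymmTensor P' Z →
        wassersteinDist P (fun ω => offDiagTensor p (fun r i => X r i ω)) P' Z
          ≤ ENNReal.ofReal (C * Real.sqrt ((n : ℝ) ^ (2 * p - 1) / d))) ∧
    (∀ (n d : ℕ → ℕ), (∀ m, 0 < d m) →
      Tendsto (fun m => (n m : ℝ) ^ (2 * p - 1) / (d m : ℝ)) atTop (𝓝 0) →
      ∀ (Ω : ℕ → Type*) (Ω' : ℕ → Type*)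
        [∀ m, MeasurableSpace (Ω m)] [∀ m, MeasurableSpace (Ω' m)]
        (P : ∀ m, Measure (Ω m)) (P' : ∀ m, Measure (Ω' m))
        [∀ m, IsProbabilityMeasure (P m)] [∀ m, IsProbabilityMeasure (P' m)]
        (X : ∀ m, Fin (n m) → Fin (d m) → Ω m → ℝ)
        (Z : ∀ m, Ω' m → EuclideanSpace ℝ (OffDiag p (n m))),
        (∀ m, IsStdGaussianMatrix (P m) (X m)) → (∀ m, IsStdGaussianSymmTensor (P' m) (Z m)) →
        Tendsto (fun m => wassersteinDist (P m)
            (fun ω => offDiagTensor p (fun r i => X m r i ω)) (P' m) (Z m)) atTop (𝓝 0)) := by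
  have hp1 : 1 ≤ p := by omega
  refine ⟨⟨tensorConstant p, tensorConstant_pos hp1, ?_⟩, ?_⟩
  · intro n d hd Ω Ω' _ _ P P' _ _ X Z hX hZ
    exact wassersteinDist_offDiagTensor_le hp1 hd hX hZ
  · intro n d hd hlim Ω Ω' _ _ P P' _ _ X Z hX hZ
    have hbound : Tendsto (fun m => ENNReal.ofReal
        (tensorConstant p * √((n m : ℝ) ^ (2 * p - 1) / (d m : ℝ)))) atTop (𝓝 0) := by
      have := ENNReal.tendsto_ofReal ((hlim.sqrt).const_mul (tensorConstant p))
      simpa using this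
    exact tendsto_of_tendsto_of_tendsto_of_le_of_le tendsto_const_nhds hbound
      (fun _ => zero_le) fun m => wassersteinDist_offDiagTensor_le hp1 (hd m) (hX m) (hZ m)
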